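/- **Setting.** Let $N$ be a number of nodes of a directed network with adjacency matrix $[a_{ij}]_{N\times N}$, $a_{ij}\in\{0,1\}$ ($a_{ij}=1$ iff node $i$ has access to node $j$), and let $w_i=\sum_{j=1}^N a_{ij}$ be the out-degree of node $i$. Let $T>0$, $\beta>0$, $a_i\ge 0$, let $0<\underline x\le\overline x$ and $0<\underline y\le\overline y$ be given bounds, and let $\mathbf C_0\in[0,1]^N$. A control $\mathbf u=(x_1,\dots,x_N,y_1,\dots,y_N)\in (L^2[0,T])^{2N}$ is admissible if $\underline x\le x_i(t)\le\overline x$ and $\underline y\le y_i(t)\le\overline y$ for all $i$ and almost every $t\in[0,T]$. Its state is the absolutely continuous solution $\mathbf C=(C_1,\dots,C_N)$ on $[0,T]$ of $$\frac{dC_i(t)}{dt}=\frac1{x_i(t)}\Big[a_i+\beta\sum_{j=1}^N a_{ji}C_j(t)\Big]\big[1-C_i(t)\big]-y_i(t)C_i(t)\ \text{ for a.e. } t\in[0,T],\qquad \mathbf C(0)=\mathbf C_0. \tag{S}$$ An admissible control is optimal if it minimizes $J(\mathbf u)=\int_0^T\sum_{i=1}^N\big[w_iC_i(t)+x_i(t)+y_i(t)\big]\,dt$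 over all admissible controls. **Theorem 2.** Let $\mathbf u^*=(\mathbf x^*,\mathbf y^*)$ be an optimal control and $\mathbf C^*$ its state. Then there is an absolutely continuous function $\boldsymbol\lambda^*=(\lambda_1^*,\dots,\lambda_N^*):[0,T]\to\mathbb R^N$ with $\boldsymbol\lambda^*(T)=\mathbf 0$ such that, for all $1\le i\le N$ and almost every $t\in[0,T]$, $$\frac{d\lambda_i^*(t)}{dt}=-w_i+y_i^*(t)\lambda_i^*(t)+\frac{\lambda_i^*(t)}{x_i^*(t)}\Big[a_i+\beta\sum_{j=1}^N a_{ji}C_j^*(t)\Big]-\beta\sum_{j=1}^N\frac{a_{ij}[1-C_j^*(t)]\lambda_j^*(t)}{x_j^*(t)},$$ $$x_i^*(t)=\max\Big\{\min\Big\{\Big(\lambda_i^*(t)\Big[a_i+\beta\sum_{j=1}^N a_{ji}C_j^*(t)\Big]\big[1-C_i^*(t)\big]\Big)^{1/2},\ \overline x\Big\},\ \underline x\Big\},$$ where the radicand is nonnegative for every $t\in[0,T]$, and $$y_i^*(t)=\begin{cases}\underline y,&\lambda_i^*(t)C_i^*(t)<1,\\ \overline y,&\lambda_i^*(t)C_i^*(t)>1.\end{cases}$$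 Together with the state equation and initial condition (S) for $\mathbf C^*$, these relations form the optimality system satisfied by $(\mathbf u^*,\mathbf C^*,\boldsymbol\lambda^*)$. -/

import Mathlib

open MeasureTheory Set

noncomputable section

/-- The data of the defense problem for an organization with `N` systems. -/
structure APTModel (N : ℕ) where
  /-- the access network: `Adj i j` iff system `i` has access to system `j` -/
  network : Digraph (Fin N)
  /-- duration of the campaign -/
  T : ℝ
  /-- attack strategy: cost per unit time for attacking a secure node -/
  a : Fin N → ℝ
  /-- infection force -/
  β : ℝ
  /-- lower and upper bounds on the prevention cost per unit time -/
  xlo : ℝ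
  xhi : ℝ
  /-- lower and upper bounds on the recovery cost per unit time -/
  ylo : ℝ
  yhi : ℝ
  /-- initial expected state (compromise probabilities) -/
  C₀ : Fin N → ℝ
  T_pos : 0 < T
  a_nonneg : ∀ i, 0 ≤ a i
  β_pos : 0 < β
  xlo_pos : 0 < xlo
  ylo_pos : 0 < ylo
  C₀_mem : ∀ i, C₀ i ∈ Icc (0 : ℝ) 1

namespace APTModel

variable {N : ℕ} (P : APTModel N)

open Classical in
/-- Adjacency matrix of the access network. -/
def A (i j : Fin N) : ℝ := if P.network.Adj i j then 1 else 0

/-- Loss rate of node `i`: its out-degree. -/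
def w (i : Fin N) : ℝ := ∑ j, P.A i j

/-- Lebesgue measure on the time interval `[0, T]`. -/
def timeMeasure : Measure ℝ := volume.restrict (Icc 0 P.T)

/-- Total attack intensity `a_i + β ∑ⱼ a_{ji} C_j` against node `i` in the state `c`. -/
def pressure (c : Fin N → ℝ) (i : Fin N) : ℝ := P.a i + P.β * ∑ j, P.A j i * c j

/-- Right-hand side `F` of the attack-defense model, at the state `c` and the control value
`(ξ, η)` (prevention, recovery). -/
def F (c ξ η : Fin N → ℝ) (i : Fin N) : ℝ :=
  1 / ξ i * P.pressure c i * (1 - c i) - η i * c i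

/-- Running cost `L`. -/
def L (c ξ η : Fin N → ℝ) : ℝ := ∑ i, (P.w i * c i + ξ i + η i)

/-- The admissible set: square integrable controls `u = (x, y)` on `[0, T]` obeying the bounds.
Elements of `L²` are represented by functions, so the bounds hold almost everywhere. -/
structure Admissible (x y : ℝ → Fin N → ℝ) : Prop where
  x_memLp : ∀ i, MemLp (fun t => x t i) 2 P.timeMeasure
  y_memLp : ∀ i, MemLp (fun t => y t i) 2 P.timeMeasure
  x_mem : ∀ᵐ t ∂P.timeMeasure, ∀ i, x t i ∈ Icc P.xlo P.xhi
  y_mem : ∀ᵐ t ∂P.timeMeasure, ∀ i, y t i ∈ Icc P.ylo P.yhi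

/-- `C` solves `C' = F(C, u)`, `C(0) = C₀` on `[0, T]` in the Carathéodory sense: it is absolutely
continuous and satisfies the equation at almost every time. -/
structure IsState (x y C : ℝ → Fin N → ℝ) : Prop where
  absCont : ∀ i, AbsolutelyContinuousOnInterval (fun t => C t i) 0 P.T
  ode : ∀ᵐ t ∂P.timeMeasure, ∀ i, HasDerivAt (fun s => C s i) (P.F (C t) (x t) (y t) i) t
  init : C 0 = P.C₀

/-- The objective functional, evaluated at a control and its state. -/
def J (x y C : ℝ → Fin N → ℝ) : ℝ := ∫ t in (0 : ℝ)..P.T, P.L (C t) (x t) (y t)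

/-- `u = (x, y)` is an optimal control: it is admissible, and with its state it attains the minimum
of the objective functional over all admissible controls. -/
def IsOptimalControl (x y : ℝ → Fin N → ℝ) : Prop :=
  P.Admissible x y ∧ ∃ C, P.IsState x y C ∧
    ∀ x' y' C', P.Admissible x' y' → P.IsState x' y' C' → P.J x y C ≤ P.J x' y' C'

/-- Right-hand side of the adjoint equation, at the state `c`, the control value `(ξ, η)` and the
adjoint value `l`. -/
def adjointRHS (c ξ η l : Fin N → ℝ) (i : Fin N) : ℝ :=
  -P.w i + η i * l i + l i / ξ i * P.pressure c i
    - P.β * ∑ j, P.A i j * (1 - c j) * l j / ξ j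

/-- The radicand `λ_i [a_i + β ∑ⱼ a_{ji} C_j] (1 - C_i)` in the formula for the optimal `x_i`. -/
def radicand (c l : Fin N → ℝ) (i : Fin N) : ℝ := l i * P.pressure c i * (1 - c i)

/-- The optimality system for the control `(x, y)`, the state `C` and the adjoint `lam`. -/
structure OptimalitySystem (x y C lam : ℝ → Fin N → ℝ) : Prop where
  state : P.IsState x y C
  adjoint_absCont : ∀ i, AbsolutelyContinuousOnInterval (fun t => lam t i) 0 P.T
  adjoint_ode : ∀ᵐ t ∂P.timeMeasure, ∀ i,
    HasDerivAt (fun s => lam s i) (P.adjointRHS (C t) (x t) (y t) (lam t) i) t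
  transversality : lam P.T = 0
  /-- the square root in the next formula is that of a nonnegative number -/
  radicand_nonneg : ∀ t ∈ Icc 0 P.T, ∀ i, 0 ≤ P.radicand (C t) (lam t) i
  x_eq : ∀ᵐ t ∂P.timeMeasure, ∀ i,
    x t i = max (min (√(P.radicand (C t) (lam t) i)) P.xhi) P.xlo
  y_eq_lo : ∀ᵐ t ∂P.timeMeasure, ∀ i, lam t i * C t i < 1 → y t i = P.ylo
  y_eq_hi : ∀ᵐ t ∂P.timeMeasure, ∀ i, 1 < lam t i * C t i → y t i = P.yhi

end APTModel

end

/-!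
The proof is a first order variation of the optimal control `u = (x, y)`, written so that the state
equation never has to be differentiated with respect to the control.

The adjoint `lam` solves a linear final value problem. Its coupling coefficients
`β a_{ij} (1 - C_j) / x_j` are nonnegative, because states stay in the unit cube
(`IsState.mem_Icc`), so `lam ≥ 0` (`exists_adjoint`) and the radicands are nonnegative. Hence the
Hamiltonian `L + ∑ᵢ lamᵢ Fᵢ` splits into terms `xᵢ + rᵢ / xᵢ` with `rᵢ ≥ 0`, terms
`yᵢ (1 - lamᵢ Cᵢ)` and terms without control: it is convex in the control, and its minimizer over
the control box is the one in the optimality system, unique up to the values `yᵢ` where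
`lamᵢ Cᵢ = 1` (`InBox.eq_opt_of_hamiltonian_eq`).

Let `v` be this pointwise minimizer and `u_ε = u + ε (v - u)`, with state `C_ε`. By Gronwall's
inequality `C_ε - C = O(ε)` (`IsState.norm_sub_le`). The pairing `∑ᵢ lamᵢ (C_ε - C)ᵢ` vanishes at
`0` and at `T`, so the integral of its derivative can be added to `J(u_ε) - J(u)` for free; the
terms of first order in `C_ε - C` then cancel, and the integrand is at most
`ε (H(v) - H(u)) + O(ε²)` (`InBox.costIncrement_le`). Optimality of `u` yields
`0 ≤ ∫ (H(v) - H(u))` as `ε → 0` (`integral_hamiltonian_opt_sub_nonneg`), while `H(v) ≤ H(u)`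
pointwise. So `H(v) = H(u)` almost everywhere, and `u` is the minimizer.

States and adjoints for merely measurable controls come from Carathéodory's existence theorem for
globally Lipschitz fields (`exists_solution_init`, `exists_solution_final`). It is applied to
truncated equations, whose solutions stay where the truncation is inactive.
-/

open MeasureTheory Set

noncomputable section

/-! ### Absolutely continuous functions -/

theorem AbsolutelyContinuousOnInterval.const (c a b : ℝ) :
    AbsolutelyContinuousOnInterval (fun _ : ℝ => c) a b :=
  ((LipschitzWith.const c).lipschitzOnWith (s := uIcc a b)).absolutelyContinuousOnInterval

theorem AbsolutelyContinuousOnInterval.sum {ι : Type*} (s : Finset ι) {f : ι → ℝ → ℝ} {a b : ℝ}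
    (hf : ∀ i ∈ s, AbsolutelyContinuousOnInterval (f i) a b) :
    AbsolutelyContinuousOnInterval (fun t => ∑ i ∈ s, f i t) a b := by
  classical
  induction s using Finset.induction_on with
  | empty => simpa using AbsolutelyContinuousOnInterval.const 0 a b
  | insert i s hi ih =>
    simp only [Finset.sum_insert hi]
    exact (hf i (by simp)).fun_add (ih fun j hj => hf j (by simp [hj]))

/-- The fundamental theorem of calculus on subintervals, for an absolutely continuous function
whose derivative is known almost everywhere. -/
theorem AbsolutelyContinuousOnInterval.integral_eq_sub_of_ae_hasDerivAt {T : ℝ} {f f' : ℝ → ℝ}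
    (hf : AbsolutelyContinuousOnInterval f 0 T)
    (hf' : ∀ᵐ t ∂volume.restrict (Icc 0 T), HasDerivAt f (f' t) t) {s t : ℝ}
    (hs : s ∈ Icc 0 T) (ht : t ∈ Icc 0 T) :
    IntervalIntegrable f' volume s t ∧ ∫ r in s..t, f' r = f t - f s := by
  have hT : (0 : ℝ) ≤ T := hs.1.trans hs.2
  have hsub : uIcc s t ⊆ uIcc 0 T := by
    rw [uIcc_of_le hT]; exact uIcc_subset_Icc hs ht
  have hst := hf.mono hsub
  rw [ae_restrict_iff' measurableSet_Icc] at hf'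
  have hae : ∀ᵐ r, r ∈ uIoc s t → deriv f r = f' r := by
    filter_upwards [hf'] with r hr hrm
    have h1 := hsub (uIoc_subset_uIcc hrm)
    rw [uIcc_of_le hT] at h1
    exact (hr h1).deriv
  refine ⟨hst.intervalIntegrable_deriv.congr_ae ?_, ?_⟩
  · exact (ae_restrict_iff' measurableSet_uIoc).2 hae
  · rw [← hst.integral_deriv_eq_sub]
    exact (intervalIntegral.integral_congr_ae hae).symm

/-- A continuous function that starts nonnegative has a last time at which it is nonnegative. -/
theorem exists_last_nonneg {v : ℝ → ℝ} {a b : ℝ} (hab : a ≤ b) (hv : ContinuousOn v (Icc a b))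
    (ha : 0 ≤ v a) : ∃ c ∈ Icc a b, 0 ≤ v c ∧ ∀ t ∈ Ioc c b, v t < 0 := by
  have hS : IsCompact (Icc a b ∩ v ⁻¹' Ici 0) :=
    isCompact_Icc.of_isClosed_subset (hv.preimage_isClosed_of_isClosed isClosed_Icc isClosed_Ici)
      inter_subset_left
  obtain ⟨c, hc, hmax⟩ := hS.exists_isGreatest ⟨a, ⟨left_mem_Icc.2 hab, ha⟩⟩
  refine ⟨c, hc.1, hc.2, fun t ht => ?_⟩
  by_contra! h
  exact absurd (hmax ⟨⟨hc.1.1.trans ht.1.le, ht.2⟩, h⟩) (not_le.2 ht.1)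

/-- An absolutely continuous function that starts nonnegative and does not decrease while it is
negative stays nonnegative. -/
theorem AbsolutelyContinuousOnInterval.nonneg_of_init {T : ℝ} {v v' : ℝ → ℝ}
    (hv : AbsolutelyContinuousOnInterval v 0 T)
    (hv' : ∀ᵐ t ∂volume.restrict (Icc 0 T), HasDerivAt v (v' t) t) (h0 : 0 ≤ v 0)
    (hpos : ∀ᵐ t ∂volume.restrict (Icc 0 T), v t < 0 → 0 ≤ v' t) {t : ℝ} (ht : t ∈ Icc 0 T) :
    0 ≤ v t := by
  by_contra! hneg
  have hT : (0 : ℝ) ≤ T := ht.1.trans ht.2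
  have hcont := hv.continuousOn
  rw [uIcc_of_le hT] at hcont
  obtain ⟨c, hc, hvc, hlt⟩ := exists_last_nonneg ht.1 (hcont.mono (Icc_subset_Icc_right ht.2)) h0
  have hint := (hv.integral_eq_sub_of_ae_hasDerivAt hv' ⟨hc.1, hc.2.trans ht.2⟩ ht).2
  have : 0 ≤ ∫ r in c..t, v' r := by
    refine intervalIntegral.integral_nonneg_of_ae_restrict hc.2 ?_
    rw [ae_restrict_iff' measurableSet_Icc] at hpos
    have hne : ∀ᵐ r : ℝ, r ≠ c := by simp [ae_iff, measure_singleton]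
    refine (ae_restrict_iff' measurableSet_Icc).2 ?_
    filter_upwards [hpos, hne] with r hr hrc hrm
    exact hr ⟨hc.1.trans hrm.1, hrm.2.trans ht.2⟩ (hlt r ⟨lt_of_le_of_ne hrm.1 hrc.symm, hrm.2⟩)
  linarith

/-- An absolutely continuous function that ends nonnegative and does not increase while it is
negative is nonnegative throughout. -/
theorem AbsolutelyContinuousOnInterval.nonneg_of_final {T : ℝ} {v v' : ℝ → ℝ}
    (hv : AbsolutelyContinuousOnInterval v 0 T)
    (hv' : ∀ᵐ t ∂volume.restrict (Icc 0 T), HasDerivAt v (v' t) t) (hT0 : 0 ≤ v T)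
    (hneg : ∀ᵐ t ∂volume.restrict (Icc 0 T), v t < 0 → v' t ≤ 0) {t : ℝ} (ht : t ∈ Icc 0 T) :
    0 ≤ v t := by
  by_contra! hlt0
  have hT : (0 : ℝ) ≤ T := ht.1.trans ht.2
  have hcont := hv.continuousOn
  rw [uIcc_of_le hT] at hcont
  obtain ⟨c, hc, hvc, hlt⟩ := exists_last_nonneg (v := fun s => v (-s)) (neg_le_neg ht.2)
    (hcont.comp continuousOn_neg fun s hs =>
      ⟨ht.1.trans (by linarith [hs.2]), by linarith [hs.1]⟩)
    (by simpa using hT0)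
  have hcm : -c ∈ Icc 0 T := ⟨by linarith [hc.2, ht.1], by linarith [hc.1]⟩
  have hint := (hv.integral_eq_sub_of_ae_hasDerivAt hv' ht hcm).2
  have : 0 ≤ ∫ r in t..(-c), -v' r := by
    refine intervalIntegral.integral_nonneg_of_ae_restrict (by linarith [hc.2]) ?_
    rw [ae_restrict_iff' measurableSet_Icc] at hneg
    have hne : ∀ᵐ r : ℝ, r ≠ -c := by simp [ae_iff, measure_singleton]
    refine (ae_restrict_iff' measurableSet_Icc).2 ?_
    filter_upwards [hneg, hne] with r hr hrc hrm
    have h1 : v (- -r) < 0 :=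
      hlt (-r) ⟨by linarith [lt_of_le_of_ne hrm.2 hrc], by linarith [hrm.1]⟩
    rw [neg_neg] at h1
    have := hr ⟨ht.1.trans hrm.1, hrm.2.trans hcm.2⟩ h1
    simpa using this
  rw [intervalIntegral.integral_neg] at this
  linarith

theorem integral_mul_exp_le (K t : ℝ) :
    ∫ s in (0 : ℝ)..t, K * Real.exp (2 * K * s) ≤ Real.exp (2 * K * t) / 2 := by
  have hd : ∀ s ∈ uIcc 0 t,
      HasDerivAt (fun s => Real.exp (2 * K * s) / 2) (K * Real.exp (2 * K * s)) s := fun s _ => by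
    exact ((((hasDerivAt_id' s).const_mul (2 * K)).exp).div_const 2).congr_deriv (by ring)
  rw [intervalIntegral.integral_eq_sub_of_hasDerivAt hd
    (Continuous.intervalIntegrable (by fun_prop) _ _)]
  simp

/-- Gronwall's inequality for an absolutely continuous curve starting at `0`, with the differential
inequality only almost everywhere. -/
theorem norm_le_of_ae_deriv_le {ι : Type*} [Fintype ι] {T K ε : ℝ} (hT : 0 ≤ T) (hK : 0 ≤ K)
    (hε : 0 ≤ ε) {D D' : ℝ → ι → ℝ}
    (hD : ∀ i, AbsolutelyContinuousOnInterval (fun t => D t i) 0 T)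
    (hD' : ∀ᵐ t ∂volume.restrict (Icc 0 T), ∀ i, HasDerivAt (fun s => D s i) (D' t i) t)
    (h0 : D 0 = 0)
    (hle : ∀ᵐ t ∂volume.restrict (Icc 0 T), ∀ i, |D' t i| ≤ K * ‖D t‖ + ε) {t : ℝ}
    (ht : t ∈ Icc 0 T) : ‖D t‖ ≤ 2 * T * Real.exp (2 * K * T) * ε := by
  have hcont : ContinuousOn D (Icc 0 T) := by
    refine continuousOn_pi.2 fun i => ?_
    have := (hD i).continuousOn
    rwa [uIcc_of_le hT] at this
  have hwcont : ContinuousOn (fun s => Real.exp (-(2 * K * s)) * ‖D s‖) (Icc 0 T) := by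
    fun_prop
  -- `m` is the maximum of the weighted norm, attained at `τ`
  obtain ⟨τ, hτ, hmax⟩ := isCompact_Icc.exists_isMaxOn (nonempty_Icc.2 hT) hwcont
  set m := Real.exp (-(2 * K * τ)) * ‖D τ‖ with hm
  have hm0 : 0 ≤ m := by positivity
  have hDm : ∀ s ∈ Icc 0 T, ‖D s‖ ≤ Real.exp (2 * K * s) * m := fun s hs => by
    have h : Real.exp (-(2 * K * s)) * ‖D s‖ ≤ m := hmax hs
    calc ‖D s‖ = Real.exp (2 * K * s) * (Real.exp (-(2 * K * s)) * ‖D s‖) := by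
          rw [← mul_assoc, ← Real.exp_add]; simp
      _ ≤ _ := by gcongr
  have hcomp : ∀ i, |D τ i| ≤ Real.exp (2 * K * τ) / 2 * m + ε * τ := fun i => by
    have hae : ∀ᵐ t ∂volume.restrict (Icc 0 T), HasDerivAt (fun s => D s i) (D' t i) t := by
      filter_upwards [hD'] with t ht using ht i
    obtain ⟨hi, hint⟩ := (hD i).integral_eq_sub_of_ae_hasDerivAt hae ⟨le_rfl, hT⟩ hτ
    have h1 : D τ i = ∫ r in (0 : ℝ)..τ, D' r i := by rw [hint]; simp [h0]
    have hci : IntervalIntegrable (fun r => K * Real.exp (2 * K * r) * m + ε) volume 0 τ :=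
      Continuous.intervalIntegrable (by fun_prop) _ _
    rw [h1]
    calc |∫ r in (0 : ℝ)..τ, D' r i| ≤ ∫ r in (0 : ℝ)..τ, (K * Real.exp (2 * K * r) * m + ε) := by
          rw [← Real.norm_eq_abs]
          refine intervalIntegral.norm_integral_le_of_norm_le hτ.1 ?_ hci
          rw [ae_restrict_iff' measurableSet_Icc] at hle
          filter_upwards [hle] with r hr hrm
          have hrT : r ∈ Icc 0 T := ⟨hrm.1.le, hrm.2.trans hτ.2⟩
          have h2 := mul_le_mul_of_nonneg_left (hDm r hrT) hK
          rw [Real.norm_eq_abs]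
          linarith [hr hrT i]
      _ = (∫ r in (0 : ℝ)..τ, K * Real.exp (2 * K * r)) * m + ε * τ := by
          rw [intervalIntegral.integral_add (Continuous.intervalIntegrable (by fun_prop) _ _)
            (by simp), intervalIntegral.integral_mul_const]
          simp [mul_comm]
      _ ≤ _ := by gcongr; exact integral_mul_exp_le K τ
  have hnorm : ‖D τ‖ ≤ Real.exp (2 * K * τ) / 2 * m + ε * τ :=
    (pi_norm_le_iff_of_nonneg (by have := hτ.1; positivity)).2 fun i => by
      rw [Real.norm_eq_abs]; exact hcomp i
  have hmle : m ≤ 2 * T * ε := by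
    have h1 : Real.exp (2 * K * τ) * m = ‖D τ‖ := by
      rw [hm, ← mul_assoc, ← Real.exp_add]; simp
    have h2 : (1 : ℝ) ≤ Real.exp (2 * K * τ) :=
      Real.one_le_exp (by have := hτ.1; positivity)
    have h3 : ε * τ ≤ ε * T := mul_le_mul_of_nonneg_left hτ.2 hε
    nlinarith
  calc ‖D t‖ ≤ Real.exp (2 * K * t) * m := hDm t ht
    _ ≤ Real.exp (2 * K * T) * (2 * T * ε) := by
        gcongr; exact ht.2
    _ = _ := by ring

/-! ### Carathéodory differential equations -/

/-- A continuous curve composed with a vector field that is measurable in time, Lipschitz in space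
and bounded at the origin is integrable. -/
theorem integrableOn_comp_of_lipschitz {E : Type*} [NormedAddCommGroup E] {T K M : ℝ}
    (hK : 0 ≤ K) {f : ℝ → E → E}
    (hmeas : ∀ X : ℝ → E, Continuous X →
      AEStronglyMeasurable (fun s => f s (X s)) (volume.restrict (Icc 0 T)))
    (hlip : ∀ᵐ s ∂volume.restrict (Icc 0 T), ∀ c c', ‖f s c - f s c'‖ ≤ K * ‖c - c'‖)
    (hbd : ∀ᵐ s ∂volume.restrict (Icc 0 T), ‖f s 0‖ ≤ M) {X : ℝ → E} (hX : Continuous X) :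
    IntegrableOn (fun s => f s (X s)) (Icc 0 T) := by
  obtain ⟨B, hB⟩ := (isCompact_Icc (a := (0 : ℝ)) (b := T)).exists_bound_of_continuousOn
    hX.continuousOn
  refine Integrable.of_bound (hmeas X hX) (K * B + M) ?_
  filter_upwards [hlip, hbd, ae_restrict_mem measurableSet_Icc] with s h1 h2 hs
  have h3 := h1 (X s) 0
  rw [sub_zero] at h3
  have h4 := norm_le_norm_add_norm_sub' (f s (X s)) (f s 0)
  have h5 := mul_le_mul_of_nonneg_left (hB s hs) hK
  linarith

/-- Carathéodory's existence theorem for a globally Lipschitz vector field, in integral form. The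
Picard map is a contraction by the factor `1/2` for the norm weighted by `exp (-2Kt)`. -/
theorem exists_integral_solution {E : Type*} [NormedAddCommGroup E] [NormedSpace ℝ E]
    [CompleteSpace E] {T K M : ℝ} (hT : 0 ≤ T) (hK : 0 ≤ K) {f : ℝ → E → E}
    (hmeas : ∀ X : ℝ → E, Continuous X →
      AEStronglyMeasurable (fun s => f s (X s)) (volume.restrict (Icc 0 T)))
    (hlip : ∀ᵐ s ∂volume.restrict (Icc 0 T), ∀ c c', ‖f s c - f s c'‖ ≤ K * ‖c - c'‖)
    (hbd : ∀ᵐ s ∂volume.restrict (Icc 0 T), ‖f s 0‖ ≤ M) (X₀ : E) :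
    ∃ X : ℝ → E, Continuous X ∧ ∀ t ∈ Icc 0 T, X t = X₀ + ∫ s in (0 : ℝ)..t, f s (X s) := by
  let Y := C(Icc (0 : ℝ) T, E)
  let ext : Y → ℝ → E := fun z s => Real.exp (2 * K * s) • z (projIcc 0 T hT s)
  have hext : ∀ z, Continuous (ext z) := fun z => by
    have : Continuous fun s => z (projIcc 0 T hT s) := z.continuous.comp continuous_projIcc
    fun_prop
  have hint : ∀ z, IntegrableOn (fun s => f s (ext z s)) (Icc 0 T) := fun z =>
    integrableOn_comp_of_lipschitz hK hmeas hlip hbd (hext z)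
  have hii : ∀ z, ∀ t ∈ Icc 0 T, IntervalIntegrable (fun s => f s (ext z s)) volume 0 t :=
    fun z t ht => by
      rw [intervalIntegrable_iff_integrableOn_Icc_of_le ht.1]
      exact (hint z).mono_set (Icc_subset_Icc_right ht.2)
  let Ψ : Y → Y := fun z =>
    ⟨fun t => Real.exp (-(2 * K * t)) • (X₀ + ∫ s in (0 : ℝ)..t, f s (ext z s)), by
      have h1 : ContinuousOn (fun t => ∫ s in (0 : ℝ)..t, f s (ext z s)) (Icc 0 T) := by
        have := intervalIntegral.continuousOn_primitive_interval (μ := volume)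
          (f := fun s => f s (ext z s)) (a := 0) (b := T) (by rw [uIcc_of_le hT]; exact hint z)
        rwa [uIcc_of_le hT] at this
      have h2 := continuousOn_iff_continuous_domRestrict.1 h1
      have h3 : Continuous fun t : Icc (0 : ℝ) T => ∫ s in (0 : ℝ)..t, f s (ext z s) := h2
      fun_prop⟩
  have hΨ : ∀ z t, Ψ z t = Real.exp (-(2 * K * t)) • (X₀ + ∫ s in (0 : ℝ)..t, f s (ext z s)) :=
    fun _ _ => rfl
  have hcontr : ContractingWith (1 / 2) Ψ := by
    refine ⟨by rw [div_lt_one] <;> norm_num, LipschitzWith.of_dist_le_mul fun z z' => ?_⟩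
    rw [ContinuousMap.dist_le (by positivity)]
    intro t
    have hb : ‖∫ s in (0 : ℝ)..t, (f s (ext z s) - f s (ext z' s))‖ ≤
        ∫ s in (0 : ℝ)..t, K * Real.exp (2 * K * s) * dist z z' := by
      refine intervalIntegral.norm_integral_le_of_norm_le t.2.1 ?_
        (Continuous.intervalIntegrable (by fun_prop) _ _)
      rw [ae_restrict_iff' measurableSet_Icc] at hlip
      filter_upwards [hlip] with s hs hsm
      refine (hs ⟨hsm.1.le, hsm.2.trans t.2.2⟩ _ _).trans ?_
      rw [mul_assoc]
      refine mul_le_mul_of_nonneg_left ?_ hK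
      simp only [ext]
      rw [← smul_sub, norm_smul, Real.norm_of_nonneg (Real.exp_pos _).le, ← dist_eq_norm]
      exact mul_le_mul_of_nonneg_left (ContinuousMap.dist_apply_le_dist _) (Real.exp_pos _).le
    rw [intervalIntegral.integral_mul_const] at hb
    have hexp : Real.exp (-(2 * K * t)) * Real.exp (2 * K * t) = 1 := by
      rw [← Real.exp_add]; simp
    calc dist (Ψ z t) (Ψ z' t)
        = Real.exp (-(2 * K * t)) * ‖∫ s in (0 : ℝ)..t, (f s (ext z s) - f s (ext z' s))‖ := by
          rw [intervalIntegral.integral_sub (hii z t t.2) (hii z' t t.2), dist_eq_norm, hΨ, hΨ,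
            ← smul_sub, norm_smul, Real.norm_of_nonneg (Real.exp_pos _).le]
          congr 2
          abel
      _ ≤ Real.exp (-(2 * K * t)) * (Real.exp (2 * K * t) / 2 * dist z z') := by
          gcongr
          refine hb.trans ?_
          gcongr
          exact integral_mul_exp_le K t
      _ = (Real.exp (-(2 * K * t)) * Real.exp (2 * K * t)) * (1 / 2 * dist z z') := by ring
      _ = _ := by rw [hexp]; simp
  have hfix : Ψ (ContractingWith.fixedPoint Ψ hcontr) = _ := hcontr.fixedPoint_isFixedPt
  set z := ContractingWith.fixedPoint Ψ hcontr
  refine ⟨ext z, hext z, fun t ht => ?_⟩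
  have h1 : z ⟨t, ht⟩ = Real.exp (-(2 * K * t)) • (X₀ + ∫ s in (0 : ℝ)..t, f s (ext z s)) := by
    conv_lhs => rw [← hfix]
    rfl
  have h2 : ext z t = Real.exp (2 * K * t) • z ⟨t, ht⟩ := by
    simp only [ext]; rw [projIcc_of_mem hT ht]
  rw [h2, h1, smul_smul, ← Real.exp_add]
  simp

/-- A solution in integral form yields an absolutely continuous solution that satisfies the
equation almost everywhere. -/
theorem exists_ac_of_integral_eq {ι : Type*} [Fintype ι] {T : ℝ} (hT : 0 ≤ T)
    {f : ℝ → (ι → ℝ) → ι → ℝ} {X : ℝ → ι → ℝ} {X₀ : ι → ℝ}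
    (hint : IntegrableOn (fun s => f s (X s)) (Icc 0 T))
    (hX : ∀ t ∈ Icc 0 T, X t = X₀ + ∫ s in (0 : ℝ)..t, f s (X s)) :
    ∃ Z : ℝ → ι → ℝ, (∀ t ∈ Icc 0 T, Z t = X t) ∧
      (∀ i, AbsolutelyContinuousOnInterval (fun t => Z t i) 0 T) ∧
      ∀ᵐ t ∂volume.restrict (Icc 0 T), ∀ i, HasDerivAt (fun s => Z s i) (f t (Z t) i) t := by
  have hii : ∀ t ∈ Icc 0 T, IntervalIntegrable (fun s => f s (X s)) volume 0 t := fun t ht => by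
    rw [intervalIntegrable_iff_integrableOn_Icc_of_le ht.1]
    exact hint.mono_set (Icc_subset_Icc_right ht.2)
  have hTm : T ∈ Icc 0 T := ⟨hT, le_rfl⟩
  have hiT : ∀ i, IntervalIntegrable (fun s => f s (X s) i) volume 0 T := fun i => by
    have := (hii T hTm)
    rw [intervalIntegrable_iff] at this ⊢
    exact Integrable.eval this i
  have hZX : ∀ t ∈ Icc 0 T, (fun i => X₀ i + ∫ s in (0 : ℝ)..t, f s (X s) i) = X t :=
    fun t ht => by
      funext i
      rw [hX t ht, Pi.add_apply]
      congr 1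
      exact (ContinuousLinearMap.proj (R := ℝ) (φ := fun _ : ι => ℝ) i).intervalIntegral_comp_comm
        (hii t ht)
  refine ⟨fun t i => X₀ i + ∫ s in (0 : ℝ)..t, f s (X s) i, hZX, fun i => ?_, ?_⟩
  · exact (AbsolutelyContinuousOnInterval.const _ _ _).fun_add
      ((hiT i).absolutelyContinuousOnInterval_intervalIntegral (by simp))
  · rw [ae_restrict_iff' measurableSet_Icc]
    have hall : ∀ᵐ t, ∀ i, t ∈ uIcc 0 T → ∀ c ∈ uIcc 0 T,
        HasDerivAt (fun x => ∫ s in c..x, f s (X s) i) (f t (X t) i) t :=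
      ae_all_iff.2 fun i => (hiT i).ae_hasDerivAt_integral
    filter_upwards [hall] with t ht htm i
    rw [hZX t htm]
    exact (ht i (by rwa [uIcc_of_le hT]) 0 (by simp)).const_add _

/-- Carathéodory's existence theorem for the initial value problem. -/
theorem exists_solution_init {ι : Type*} [Fintype ι] {T K M : ℝ} (hT : 0 ≤ T) (hK : 0 ≤ K)
    {f : ℝ → (ι → ℝ) → ι → ℝ}
    (hmeas : ∀ X : ℝ → ι → ℝ, Continuous X →
      AEStronglyMeasurable (fun s => f s (X s)) (volume.restrict (Icc 0 T)))
    (hlip : ∀ᵐ s ∂volume.restrict (Icc 0 T), ∀ c c', ‖f s c - f s c'‖ ≤ K * ‖c - c'‖)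
    (hbd : ∀ᵐ s ∂volume.restrict (Icc 0 T), ‖f s 0‖ ≤ M) (X₀ : ι → ℝ) :
    ∃ X : ℝ → ι → ℝ, X 0 = X₀ ∧
      (∀ i, AbsolutelyContinuousOnInterval (fun t => X t i) 0 T) ∧
      ∀ᵐ t ∂volume.restrict (Icc 0 T), ∀ i, HasDerivAt (fun s => X s i) (f t (X t) i) t := by
  obtain ⟨X, hX, heq⟩ := exists_integral_solution hT hK hmeas hlip hbd X₀
  obtain ⟨Z, hZX, hac, hd⟩ := exists_ac_of_integral_eq hT
    (integrableOn_comp_of_lipschitz hK hmeas hlip hbd hX) heq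
  refine ⟨Z, ?_, hac, hd⟩
  rw [hZX 0 ⟨le_rfl, hT⟩, heq 0 ⟨le_rfl, hT⟩]
  simp

theorem measurePreserving_sub_left_restrict_Icc (T : ℝ) :
    MeasurePreserving (fun s : ℝ => T - s) (volume.restrict (Icc 0 T))
      (volume.restrict (Icc 0 T)) := by
  have h := (Measure.measurePreserving_sub_left volume T).restrict_preimage
    (s := Icc 0 T) measurableSet_Icc
  rwa [preimage_const_sub_Icc, sub_self, sub_zero] at h

/-- Carathéodory's existence theorem for the final value problem, by time reversal. -/
theorem exists_solution_final {ι : Type*} [Fintype ι] {T K M : ℝ} (hT : 0 ≤ T) (hK : 0 ≤ K)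
    {f : ℝ → (ι → ℝ) → ι → ℝ}
    (hmeas : ∀ X : ℝ → ι → ℝ, Continuous X →
      AEStronglyMeasurable (fun s => f s (X s)) (volume.restrict (Icc 0 T)))
    (hlip : ∀ᵐ s ∂volume.restrict (Icc 0 T), ∀ c c', ‖f s c - f s c'‖ ≤ K * ‖c - c'‖)
    (hbd : ∀ᵐ s ∂volume.restrict (Icc 0 T), ‖f s 0‖ ≤ M) (X₁ : ι → ℝ) :
    ∃ X : ℝ → ι → ℝ, X T = X₁ ∧
      (∀ i, AbsolutelyContinuousOnInterval (fun t => X t i) 0 T) ∧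
      ∀ᵐ t ∂volume.restrict (Icc 0 T), ∀ i, HasDerivAt (fun s => X s i) (f t (X t) i) t := by
  have hmp := (measurePreserving_sub_left_restrict_Icc T).quasiMeasurePreserving
  obtain ⟨Y, hY, heq⟩ := exists_integral_solution (f := fun s c => -f (T - s) c) hT hK
    (fun X hX => by
      have h := (hmeas (fun s => X (T - s)) (by fun_prop)).comp_quasiMeasurePreserving hmp
      simpa [Function.comp_def] using! h.neg)
    (by
      filter_upwards [hmp.ae hlip] with s hs c c'
      rw [neg_sub_neg, norm_sub_rev]
      exact hs c c')
    (by filter_upwards [hmp.ae hbd] with s hs using by simpa using hs) X₁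
  set X : ℝ → ι → ℝ := fun t => Y (T - t) with hXdef
  have hX : Continuous X := by fun_prop
  have hint : IntegrableOn (fun s => f s (X s)) (Icc 0 T) :=
    integrableOn_comp_of_lipschitz hK hmeas hlip hbd hX
  have hback : ∀ t ∈ Icc 0 T, X t = X₁ - ∫ s in t..T, f s (X s) := fun t ht => by
    have h1 := heq (T - t) ⟨by linarith [ht.2], by linarith [ht.1]⟩
    have h2 := intervalIntegral.integral_comp_sub_left (a := 0) (b := T - t)
      (fun s => f s (X s)) T
    simp only [sub_sub_cancel, sub_zero, hXdef] at h2
    simp only [hXdef]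
    rw [h1, intervalIntegral.integral_neg, h2, sub_eq_add_neg]
  have hii : ∀ a ∈ Icc 0 T, ∀ b ∈ Icc 0 T, IntervalIntegrable (fun s => f s (X s)) volume a b :=
    fun a ha b hb => (hint.mono_set (uIcc_subset_Icc ha hb)).intervalIntegrable
  obtain ⟨Z, hZX, hac, hd⟩ := exists_ac_of_integral_eq (X₀ := X 0) hT hint (fun t ht => by
    have h0 : (0 : ℝ) ∈ Icc 0 T := ⟨le_rfl, hT⟩
    have hTm : T ∈ Icc 0 T := ⟨hT, le_rfl⟩
    rw [hback t ht, hback 0 h0,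
      ← intervalIntegral.integral_add_adjacent_intervals (hii 0 h0 t ht) (hii t ht T hTm)]
    abel)
  refine ⟨Z, ?_, hac, hd⟩
  rw [hZX T ⟨hT, le_rfl⟩, hback T ⟨hT, le_rfl⟩]
  simp

namespace APTModel

variable {N : ℕ} (P : APTModel N)

/-! ### Bounds for the attack-defense vector field -/

theorem A_nonneg (i j : Fin N) : 0 ≤ P.A i j := by
  unfold A; split_ifs <;> norm_num

theorem A_le_one (i j : Fin N) : P.A i j ≤ 1 := by
  unfold A; split_ifs <;> norm_num

theorem w_nonneg (i : Fin N) : 0 ≤ P.w i := Finset.sum_nonneg fun j _ => P.A_nonneg i j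

theorem abs_sum_A_mul_le {d : Fin N → ℝ} {M : ℝ} (hd : ∀ j, |d j| ≤ M) (i : Fin N) :
    |∑ j, P.A j i * d j| ≤ N * M := by
  calc |∑ j, P.A j i * d j| ≤ ∑ j, |P.A j i * d j| := Finset.abs_sum_le_sum_abs _ _
    _ ≤ ∑ _j : Fin N, M := Finset.sum_le_sum fun j _ => by
        rw [abs_mul, abs_of_nonneg (P.A_nonneg j i)]
        exact (mul_le_of_le_one_left (abs_nonneg _) (P.A_le_one j i)).trans (hd j)
    _ = N * M := by simp

theorem pressure_sub (c c' : Fin N → ℝ) (i : Fin N) :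
    P.pressure c' i - P.pressure c i = P.β * ∑ j, P.A j i * (c' j - c j) := by
  simp only [pressure, mul_sub, Finset.sum_sub_distrib]
  ring

theorem pressure_nonneg {c : Fin N → ℝ} (hc : ∀ j, 0 ≤ c j) (i : Fin N) : 0 ≤ P.pressure c i :=
  add_nonneg (P.a_nonneg i) (mul_nonneg P.β_pos.le
    (Finset.sum_nonneg fun j _ => mul_nonneg (P.A_nonneg j i) (hc j)))

/-- A bound for the attack intensity at the states of size at most `M`. -/
def pressureBound (M : ℝ) : ℝ := ∑ i, P.a i + P.β * (N * M)

theorem pressureBound_nonneg {M : ℝ} (hM : 0 ≤ M) : 0 ≤ P.pressureBound M :=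
  add_nonneg (Finset.sum_nonneg fun i _ => P.a_nonneg i)
    (mul_nonneg P.β_pos.le (by positivity))

theorem abs_pressure_le {c : Fin N → ℝ} {M : ℝ} (hc : ∀ j, |c j| ≤ M) (i : Fin N) :
    |P.pressure c i| ≤ P.pressureBound M := by
  have h1 := P.abs_sum_A_mul_le hc i
  have h2 : P.a i ≤ ∑ i, P.a i :=
    Finset.single_le_sum (fun j _ => P.a_nonneg j) (Finset.mem_univ i)
  calc |P.pressure c i| ≤ |P.a i| + |P.β * ∑ j, P.A j i * c j| := abs_add_le _ _
    _ ≤ _ := by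
      rw [abs_of_nonneg (P.a_nonneg i), abs_mul, abs_of_pos P.β_pos]
      exact add_le_add h2 (mul_le_mul_of_nonneg_left h1 P.β_pos.le)

/-- A Lipschitz constant of the vector field on the states of size at most `M`, uniform in the
control. -/
def lipschitzConst (M : ℝ) : ℝ :=
  1 / P.xlo * (P.β * N * (1 + M) + P.pressureBound M) + |P.yhi|

theorem lipschitzConst_nonneg {M : ℝ} (hM : 0 ≤ M) : 0 ≤ P.lipschitzConst M := by
  have := P.pressureBound_nonneg hM
  have := P.xlo_pos
  have := P.β_pos
  unfold lipschitzConst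
  positivity

/-- The control value `(ξ, η)` lies in the control box. -/
def InBox (ξ η : Fin N → ℝ) : Prop :=
  (∀ i, ξ i ∈ Icc P.xlo P.xhi) ∧ ∀ i, η i ∈ Icc P.ylo P.yhi

variable {P}

theorem Admissible.inBox {x y : ℝ → Fin N → ℝ} (h : P.Admissible x y) :
    ∀ᵐ t ∂volume.restrict (Icc 0 P.T), P.InBox (x t) (y t) := by
  filter_upwards [h.x_mem, h.y_mem] with t hx hy using ⟨hx, hy⟩

theorem InBox.x_pos {ξ η : Fin N → ℝ} (h : P.InBox ξ η) (i : Fin N) : 0 < ξ i :=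
  P.xlo_pos.trans_le (h.1 i).1

theorem InBox.one_div_le {ξ η : Fin N → ℝ} (h : P.InBox ξ η) (i : Fin N) :
    1 / ξ i ≤ 1 / P.xlo := one_div_le_one_div_of_le P.xlo_pos (h.1 i).1

theorem InBox.one_div_nonneg {ξ η : Fin N → ℝ} (h : P.InBox ξ η) (i : Fin N) :
    0 ≤ 1 / ξ i := (_root_.one_div_pos.2 (h.x_pos i)).le

theorem InBox.y_nonneg {ξ η : Fin N → ℝ} (h : P.InBox ξ η) (i : Fin N) : 0 ≤ η i :=
  P.ylo_pos.le.trans (h.2 i).1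

theorem InBox.y_le {ξ η : Fin N → ℝ} (h : P.InBox ξ η) (i : Fin N) : η i ≤ |P.yhi| :=
  (h.2 i).2.trans (le_abs_self _)

theorem InBox.abs_F_sub_le {ξ η c c' : Fin N → ℝ} {M : ℝ} (hu : P.InBox ξ η)
    (hc : ∀ j, |c j| ≤ M) (hc' : ∀ j, |c' j| ≤ M) (i : Fin N) :
    |P.F c' ξ η i - P.F c ξ η i| ≤ P.lipschitzConst M * ‖c' - c‖ := by
  have hd : ∀ j, |c' j - c j| ≤ ‖c' - c‖ := fun j => by
    simpa [Real.norm_eq_abs] using norm_le_pi_norm (c' - c) j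
  have hM : 0 ≤ M := (abs_nonneg _).trans (hc i)
  have hQ := P.pressureBound_nonneg hM
  have hp := P.abs_pressure_le hc i
  have hx := hu.one_div_le i
  have hx0 := hu.one_div_nonneg i
  have hβ := P.β_pos
  have hxlo := P.xlo_pos
  have hdp : |P.pressure c' i - P.pressure c i| ≤ P.β * (N * ‖c' - c‖) := by
    rw [P.pressure_sub, abs_mul, abs_of_pos hβ]
    exact mul_le_mul_of_nonneg_left (P.abs_sum_A_mul_le hd i) hβ.le
  have h1 : |1 - c' i| ≤ 1 + M := (abs_sub _ _).trans (by rw [abs_one]; linarith [hc' i])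
  calc |P.F c' ξ η i - P.F c ξ η i|
      = |1 / ξ i * ((P.pressure c' i - P.pressure c i) * (1 - c' i)
          - P.pressure c i * (c' i - c i)) - η i * (c' i - c i)| := by
        unfold F; congr 1; ring
    _ ≤ 1 / ξ i * (|P.pressure c' i - P.pressure c i| * |1 - c' i|
          + |P.pressure c i| * |c' i - c i|) + η i * |c' i - c i| := by
        refine (abs_sub _ _).trans ?_
        rw [abs_mul, abs_mul (η i), abs_of_nonneg hx0, abs_of_nonneg (hu.y_nonneg i)]
        gcongr
        refine (abs_sub _ _).trans ?_
        rw [abs_mul, abs_mul]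
    _ ≤ 1 / P.xlo * (P.β * (N * ‖c' - c‖) * (1 + M) + P.pressureBound M * ‖c' - c‖)
          + |P.yhi| * ‖c' - c‖ := by
        gcongr
        · exact hd i
        · exact hu.y_le i
        · exact hd i
    _ = _ := by unfold lipschitzConst; ring

theorem InBox.abs_F_le {ξ η c : Fin N → ℝ} (hu : P.InBox ξ η) (hc : ∀ j, c j ∈ Icc (0 : ℝ) 1)
    (i : Fin N) : |P.F c ξ η i| ≤ 1 / P.xlo * P.pressureBound 1 + |P.yhi| := by
  have hca : ∀ j, |c j| ≤ 1 := fun j => abs_le.2 ⟨by linarith [(hc j).1], (hc j).2⟩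
  have hQ := P.pressureBound_nonneg zero_le_one
  have hp := P.abs_pressure_le hca i
  have hx := hu.one_div_le i
  have hx0 := hu.one_div_nonneg i
  have hxlo := P.xlo_pos
  have h1 : |1 - c i| ≤ 1 := abs_le.2 ⟨by linarith [(hc i).2], by linarith [(hc i).1]⟩
  calc |P.F c ξ η i| ≤ 1 / ξ i * |P.pressure c i| * |1 - c i| + η i * |c i| := by
        unfold F
        refine (abs_sub _ _).trans ?_
        rw [abs_mul, abs_mul, abs_mul, abs_of_nonneg hx0, abs_of_nonneg (hu.y_nonneg i)]
    _ ≤ 1 / P.xlo * P.pressureBound 1 * 1 + |P.yhi| * 1 := by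
        gcongr
        · exact hu.y_le i
        · exact hca i
    _ = _ := by ring

/-! ### The state equation -/

/-- The coordinatewise projection of a state to the unit cube. -/
def clamp (c : Fin N → ℝ) : Fin N → ℝ := fun i => max (min (c i) 1) 0

theorem clamp_mem (c : Fin N → ℝ) (i : Fin N) : clamp c i ∈ Icc (0 : ℝ) 1 :=
  ⟨le_max_right _ _, max_le (min_le_right _ _) zero_le_one⟩

theorem abs_clamp_le (c : Fin N → ℝ) (i : Fin N) : |clamp c i| ≤ 1 := by
  rw [abs_of_nonneg (clamp_mem c i).1]; exact (clamp_mem c i).2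

theorem clamp_eq_self {c : Fin N → ℝ} (hc : ∀ i, c i ∈ Icc (0 : ℝ) 1) : clamp c = c := by
  funext i
  simp [clamp, (hc i).1, (hc i).2]

theorem norm_clamp_sub_le (c c' : Fin N → ℝ) : ‖clamp c - clamp c'‖ ≤ ‖c - c'‖ := by
  refine (pi_norm_le_iff_of_nonneg (norm_nonneg _)).2 fun i => ?_
  refine le_trans ?_ (norm_le_pi_norm (c - c') i)
  simp only [Pi.sub_apply, Real.norm_eq_abs, clamp]
  refine (abs_max_sub_max_le_abs _ _ _).trans ?_
  simpa using abs_min_sub_min_le_max (c i) 1 (c' i) 1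

theorem Admissible.x_aemeasurable {x y : ℝ → Fin N → ℝ} (h : P.Admissible x y) (i : Fin N) :
    AEMeasurable (fun t => x t i) (volume.restrict (Icc 0 P.T)) :=
  (h.x_memLp i).aestronglyMeasurable.aemeasurable

theorem Admissible.y_aemeasurable {x y : ℝ → Fin N → ℝ} (h : P.Admissible x y) (i : Fin N) :
    AEMeasurable (fun t => y t i) (volume.restrict (Icc 0 P.T)) :=
  (h.y_memLp i).aestronglyMeasurable.aemeasurable

theorem aemeasurable_pressure {μ : Measure ℝ} {C : ℝ → Fin N → ℝ}
    (hC : ∀ i, AEMeasurable (fun t => C t i) μ) (i : Fin N) :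
    AEMeasurable (fun t => P.pressure (C t) i) μ := by
  unfold pressure
  fun_prop

theorem aemeasurable_F {μ : Measure ℝ} {x y C : ℝ → Fin N → ℝ}
    (hx : ∀ i, AEMeasurable (fun t => x t i) μ) (hy : ∀ i, AEMeasurable (fun t => y t i) μ)
    (hC : ∀ i, AEMeasurable (fun t => C t i) μ) (i : Fin N) :
    AEMeasurable (fun t => P.F (C t) (x t) (y t) i) μ := by
  have hp := aemeasurable_pressure (P := P) hC i
  unfold F
  fun_prop

/-- Every admissible control has a state with values in the unit cube. It is obtained from the
equation in which the state is clamped to the cube: its solution cannot leave the cube, since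
outside it the truncated vector field points inwards. -/
theorem Admissible.exists_isState {x y : ℝ → Fin N → ℝ} (h : P.Admissible x y) :
    ∃ C, P.IsState x y C ∧ ∀ t ∈ Icc 0 P.T, ∀ i, C t i ∈ Icc (0 : ℝ) 1 := by
  have hbox := h.inBox
  obtain ⟨C, h0, hac, hd⟩ := exists_solution_init
    (f := fun t c => P.F (clamp c) (x t) (y t)) (K := P.lipschitzConst 1)
    (M := 1 / P.xlo * P.pressureBound 1 + |P.yhi|)
    P.T_pos.le (P.lipschitzConst_nonneg zero_le_one)
    (fun X hX => by
      refine (aemeasurable_pi_iff.2 fun i =>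
        aemeasurable_F h.x_aemeasurable h.y_aemeasurable (fun i => ?_) i).aestronglyMeasurable
      unfold clamp
      fun_prop)
    (by
      filter_upwards [hbox] with t ht c c'
      refine (pi_norm_le_iff_of_nonneg
        (mul_nonneg (P.lipschitzConst_nonneg zero_le_one) (norm_nonneg _))).2 fun i => ?_
      refine (ht.abs_F_sub_le (abs_clamp_le c') (abs_clamp_le c) i).trans ?_
      exact mul_le_mul_of_nonneg_left (norm_clamp_sub_le c c')
        (P.lipschitzConst_nonneg zero_le_one))
    (by
      filter_upwards [hbox] with t ht
      refine (pi_norm_le_iff_of_nonneg ?_).2 fun i => ht.abs_F_le (clamp_mem 0) i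
      have := P.xlo_pos
      have := P.pressureBound_nonneg zero_le_one
      positivity)
    P.C₀
  have hmem : ∀ t ∈ Icc 0 P.T, ∀ i, C t i ∈ Icc (0 : ℝ) 1 := fun t ht i => by
    have hdi : ∀ᵐ t ∂volume.restrict (Icc 0 P.T),
        HasDerivAt (fun s => C s i) (P.F (clamp (C t)) (x t) (y t) i) t := by
      filter_upwards [hd] with t ht using ht i
    have hC0 := P.C₀_mem i
    rw [← h0] at hC0
    constructor
    · refine (hac i).nonneg_of_init hdi hC0.1 ?_ ht
      filter_upwards [hbox] with s hs hneg
      have hc : clamp (C s) i = 0 := max_eq_right ((min_le_left _ _).trans hneg.le)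
      have hp := P.pressure_nonneg (fun j => (clamp_mem (C s) j).1) i
      have hx := hs.one_div_nonneg i
      simp only [F, hc]
      simpa using mul_nonneg (by simpa using hx) hp
    · refine sub_nonneg.1 (((AbsolutelyContinuousOnInterval.const 1 0 P.T).fun_sub
        (hac i)).nonneg_of_init (v' := fun t => -P.F (clamp (C t)) (x t) (y t) i) ?_
        (sub_nonneg.2 hC0.2) ?_ ht)
      · filter_upwards [hdi] with s hs using hs.const_sub 1
      · filter_upwards [hbox] with s hs hneg
        have hc : clamp (C s) i = 1 := by
          have : 1 ≤ C s i := by linarith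
          simp [clamp, this]
        have := hs.y_nonneg i
        simpa [F, hc] using this
  refine ⟨C, ⟨hac, ?_, h0⟩, hmem⟩
  filter_upwards [hd, ae_restrict_mem (measurableSet_Icc (a := 0) (b := P.T))] with t ht htm
  rwa [clamp_eq_self (hmem t htm)] at ht

theorem IsState.continuousOn {x y C : ℝ → Fin N → ℝ} (h : P.IsState x y C) :
    ContinuousOn C (Icc 0 P.T) :=
  continuousOn_pi.2 fun i => by
    have := (h.absCont i).continuousOn
    rwa [uIcc_of_le P.T_pos.le] at this

/-- States depend in a Lipschitz way on the control: a control that changes the vector field along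
the state `C` by at most `ε` moves the state by at most a multiple of `ε`. -/
theorem IsState.norm_sub_le {x y C x' y' C' : ℝ → Fin N → ℝ} (h : P.IsState x y C)
    (h' : P.IsState x' y' C') (hadm' : P.Admissible x' y') {M ε : ℝ} (hM : 0 ≤ M) (hε : 0 ≤ ε)
    (hC : ∀ t ∈ Icc 0 P.T, ∀ i, |C t i| ≤ M) (hC' : ∀ t ∈ Icc 0 P.T, ∀ i, |C' t i| ≤ M)
    (hle : ∀ᵐ t ∂volume.restrict (Icc 0 P.T), ∀ i,
      |P.F (C t) (x' t) (y' t) i - P.F (C t) (x t) (y t) i| ≤ ε) {t : ℝ} (ht : t ∈ Icc 0 P.T) :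
    ‖C' t - C t‖ ≤ 2 * P.T * Real.exp (2 * P.lipschitzConst M * P.T) * ε := by
  refine norm_le_of_ae_deriv_le (D := fun t => C' t - C t)
    (D' := fun t i => P.F (C' t) (x' t) (y' t) i - P.F (C t) (x t) (y t) i)
    P.T_pos.le (P.lipschitzConst_nonneg hM) hε (fun i => (h'.absCont i).fun_sub (h.absCont i))
    ?_ ?_ ?_ ht
  · filter_upwards [h.ode, h'.ode] with t h1 h2 i using (h2 i).sub (h1 i)
  · simp [h.init, h'.init]
  · filter_upwards [hle, hadm'.inBox, ae_restrict_mem (measurableSet_Icc (a := 0) (b := P.T))]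
      with s h1 h2 hs i
    have h3 := h2.abs_F_sub_le (hC s hs) (hC' s hs) i
    have h4 := abs_sub_le (P.F (C' s) (x' s) (y' s) i) (P.F (C s) (x' s) (y' s) i)
      (P.F (C s) (x s) (y s) i)
    linarith [h1 i]

theorem IsState.unique {x y C C' : ℝ → Fin N → ℝ} (hadm : P.Admissible x y)
    (h : P.IsState x y C) (h' : P.IsState x y C') : EqOn C' C (Icc 0 P.T) := by
  intro t ht
  obtain ⟨B, hB⟩ := isCompact_Icc.exists_bound_of_continuousOn h.continuousOn
  obtain ⟨B', hB'⟩ := isCompact_Icc.exists_bound_of_continuousOn h'.continuousOn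
  have h1 := h.norm_sub_le h' hadm (M := max B B') (ε := 0)
    ((norm_nonneg _).trans ((hB t ht).trans (le_max_left _ _))) le_rfl
    (fun s hs i => (norm_le_pi_norm (C s) i).trans ((hB s hs).trans (le_max_left _ _)))
    (fun s hs i => (norm_le_pi_norm (C' s) i).trans ((hB' s hs).trans (le_max_right _ _)))
    (by simp) ht
  rw [mul_zero] at h1
  exact sub_eq_zero.1 (norm_le_zero_iff.1 h1)

theorem IsState.mem_Icc {x y C : ℝ → Fin N → ℝ} (h : P.IsState x y C)
    (hadm : P.Admissible x y) {t : ℝ} (ht : t ∈ Icc 0 P.T) (i : Fin N) :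
    C t i ∈ Icc (0 : ℝ) 1 := by
  obtain ⟨C', h', hmem⟩ := hadm.exists_isState
  rw [h'.unique hadm h ht]
  exact hmem t ht i

/-- The cost of an optimal control is the minimum, whichever state is chosen to compute it, as the
state is unique. -/
theorem IsOptimalControl.J_le {x y C : ℝ → Fin N → ℝ} (hu : P.IsOptimalControl x y)
    (hC : P.IsState x y C) {x' y' C' : ℝ → Fin N → ℝ} (h : P.Admissible x' y')
    (h' : P.IsState x' y' C') : P.J x y C ≤ P.J x' y' C' := by
  obtain ⟨hadm, C₁, hC₁, hmin⟩ := hu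
  refine le_of_eq_of_le ?_ (hmin x' y' C' h h')
  refine intervalIntegral.integral_congr fun t ht => ?_
  rw [uIcc_of_le P.T_pos.le] at ht
  simp only [hC₁.unique hadm hC ht]

/-! ### The adjoint equation -/

/-- The final value problem for the adjoint has a nonnegative solution. It is obtained from the
equation in which the coupling terms see only the positive parts of the adjoint variables: then a
negative component cannot increase, so that no component that vanishes at `T` is ever negative. -/
theorem exists_adjoint {x y C : ℝ → Fin N → ℝ} (hadm : P.Admissible x y) (hC : P.IsState x y C) :
    ∃ lam : ℝ → Fin N → ℝ, lam P.T = 0 ∧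
      (∀ i, AbsolutelyContinuousOnInterval (fun t => lam t i) 0 P.T) ∧
      (∀ᵐ t ∂volume.restrict (Icc 0 P.T), ∀ i,
        HasDerivAt (fun s => lam s i) (P.adjointRHS (C t) (x t) (y t) (lam t) i) t) ∧
      ∀ t ∈ Icc 0 P.T, ∀ i, 0 ≤ lam t i := by
  have hbox := hadm.inBox
  have hmemT := ae_restrict_mem (μ := volume) (measurableSet_Icc (a := 0) (b := P.T))
  have hCm : ∀ i, AEMeasurable (fun t => C t i) (volume.restrict (Icc 0 P.T)) := fun i =>
    (continuousOn_pi.1 hC.continuousOn i).aemeasurable measurableSet_Icc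
  have hx := hadm.x_aemeasurable
  have hy := hadm.y_aemeasurable
  have hβ := P.β_pos
  have hxlo := P.xlo_pos
  have hQ := P.pressureBound_nonneg zero_le_one
  have hCabs : ∀ t ∈ Icc 0 P.T, ∀ i, |C t i| ≤ 1 := fun t ht i => by
    rw [abs_of_nonneg (hC.mem_Icc hadm ht i).1]; exact (hC.mem_Icc hadm ht i).2
  let G : ℝ → (Fin N → ℝ) → Fin N → ℝ := fun t l i =>
    -P.w i + y t i * l i + l i / x t i * P.pressure (C t) i
      - P.β * ∑ j, P.A i j * (1 - C t j) * max (l j) 0 / x t j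
  obtain ⟨lam, hT, hac, hd⟩ := exists_solution_final (f := G)
    (K := |P.yhi| + 1 / P.xlo * P.pressureBound 1 + P.β * (N * (1 / P.xlo)))
    (M := ∑ i, P.w i)
    P.T_pos.le (by positivity)
    (fun X hX => by
      refine (aemeasurable_pi_iff.2 fun i => ?_).aestronglyMeasurable
      have hp := aemeasurable_pressure (P := P) hCm i
      simp only [G]
      fun_prop)
    (by
      filter_upwards [hbox, hmemT] with t hu ht l l'
      refine (pi_norm_le_iff_of_nonneg (by positivity)).2 fun i => ?_
      have hd : ∀ j, |l j - l' j| ≤ ‖l - l'‖ := fun j => norm_le_pi_norm (l - l') j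
      have hsum : |∑ j, P.A i j * (1 - C t j) * (max (l j) 0 - max (l' j) 0) / x t j| ≤
          N * (1 / P.xlo * ‖l - l'‖) := by
        refine (Finset.abs_sum_le_sum_abs _ _).trans ?_
        refine (Finset.sum_le_sum (g := fun _ => 1 / P.xlo * ‖l - l'‖) fun j _ => ?_).trans
          (by simp)
        have h1 := hu.one_div_le j
        have h0 := hu.one_div_nonneg j
        have hCj := hC.mem_Icc hadm ht j
        rw [div_eq_mul_one_div, abs_mul, abs_mul, abs_mul, abs_of_nonneg h0,
          abs_of_nonneg (P.A_nonneg i j), abs_of_nonneg (sub_nonneg.2 hCj.2), mul_comm]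
        refine mul_le_mul h1 ?_ (by have := P.A_nonneg i j; have := sub_nonneg.2 hCj.2; positivity)
          (by positivity)
        calc P.A i j * (1 - C t j) * |max (l j) 0 - max (l' j) 0|
            ≤ 1 * 1 * ‖l - l'‖ := by
              have := sub_nonneg.2 hCj.2
              gcongr
              · exact P.A_le_one i j
              · linarith [hCj.1]
              · exact (abs_max_sub_max_le_abs _ _ _).trans (hd j)
          _ = _ := by ring
      have hsplit : (G t l - G t l') i = y t i * (l i - l' i)
          + 1 / x t i * P.pressure (C t) i * (l i - l' i)
          - P.β * ∑ j, P.A i j * (1 - C t j) * (max (l j) 0 - max (l' j) 0) / x t j := by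
        simp only [G, Pi.sub_apply, mul_sub, sub_div, Finset.sum_sub_distrib]
        ring
      have hp := P.abs_pressure_le (hCabs t ht) i
      have h1 := hu.one_div_le i
      have h0 := hu.one_div_nonneg i
      rw [hsplit, Real.norm_eq_abs]
      calc _ ≤ y t i * |l i - l' i| + 1 / x t i * |P.pressure (C t) i| * |l i - l' i|
            + P.β * |∑ j, P.A i j * (1 - C t j) * (max (l j) 0 - max (l' j) 0) / x t j| := by
            refine (abs_sub _ _).trans (add_le_add ((abs_add_le _ _).trans ?_) ?_)
            · rw [abs_mul, abs_mul, abs_mul, abs_of_nonneg h0, abs_of_nonneg (hu.y_nonneg i)]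
            · rw [abs_mul, abs_of_pos hβ]
        _ ≤ |P.yhi| * ‖l - l'‖ + 1 / P.xlo * P.pressureBound 1 * ‖l - l'‖
            + P.β * (N * (1 / P.xlo * ‖l - l'‖)) := by
            gcongr
            · exact hu.y_le i
            · exact hd i
            · exact hd i
        _ = _ := by ring)
    (by
      refine Filter.Eventually.of_forall fun t => ?_
      refine (pi_norm_le_iff_of_nonneg (Finset.sum_nonneg fun i _ => P.w_nonneg i)).2 fun i => ?_
      have h1 : G t 0 i = -P.w i := by simp [G]
      rw [h1, norm_neg, Real.norm_of_nonneg (P.w_nonneg i)]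
      exact Finset.single_le_sum (fun j _ => P.w_nonneg j) (Finset.mem_univ i))
    0
  have hnn : ∀ t ∈ Icc 0 P.T, ∀ i, 0 ≤ lam t i := fun t ht i => by
    refine (hac i).nonneg_of_final (v' := fun t => G t (lam t) i) ?_ (by simp [hT]) ?_ ht
    · filter_upwards [hd] with s hs using hs i
    · filter_upwards [hbox, hmemT] with s hu hs hneg
      have h1 : y s i * lam s i ≤ 0 := mul_nonpos_of_nonneg_of_nonpos (hu.y_nonneg i) hneg.le
      have h2 : lam s i / x s i * P.pressure (C s) i ≤ 0 :=
        mul_nonpos_of_nonpos_of_nonneg (div_nonpos_of_nonpos_of_nonneg hneg.le (hu.x_pos i).le)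
          (P.pressure_nonneg (fun j => (hC.mem_Icc hadm hs j).1) i)
      have h3 : 0 ≤ P.β * ∑ j, P.A i j * (1 - C s j) * max (lam s j) 0 / x s j :=
        mul_nonneg hβ.le (Finset.sum_nonneg fun j _ => div_nonneg (mul_nonneg (mul_nonneg
          (P.A_nonneg i j) (sub_nonneg.2 (hC.mem_Icc hadm hs j).2)) (le_max_right _ _))
          (hu.x_pos j).le)
      have h4 := P.w_nonneg i
      simp only [G]
      linarith
  refine ⟨lam, hT, hac, ?_, hnn⟩
  filter_upwards [hd, hmemT] with t ht htm i
  have h1 : G t (lam t) i = P.adjointRHS (C t) (x t) (y t) (lam t) i := by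
    simp only [G, adjointRHS, max_eq_left (hnn t htm _)]
  exact h1 ▸ ht i

end APTModel

/-! ### Pointwise minimization of the Hamiltonian -/

/-- For `r ≥ 0`, the convex function `ξ ↦ ξ + r / ξ` on `[a, b]` is minimized at the projection of
`√r` to `[a, b]`, with a quadratic margin. -/
theorem sq_div_le_of_clamp_sqrt {a b r ξ : ℝ} (ha : 0 < a) (hr : 0 ≤ r) (hξ : ξ ∈ Icc a b) :
    (ξ - max (min (√r) b) a) ^ 2 / ξ ≤
      ξ + r * (1 / ξ) - (max (min (√r) b) a + r * (1 / max (min (√r) b) a)) := by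
  set z := max (min (√r) b) a with hz
  have hz0 : 0 < z := ha.trans_le (le_max_right _ _)
  have hξ0 : 0 < ξ := ha.trans_le hξ.1
  have hab : a ≤ b := hξ.1.trans hξ.2
  have hs := Real.sqrt_nonneg r
  have hsq := Real.sq_sqrt hr
  -- the variational inequality that characterizes the projection, squared
  have hvar : 0 ≤ (ξ - z) * (z ^ 2 - r) := by
    rcases le_total (√r) a with h | h
    · have hza : z = a := by rw [hz, min_eq_left (h.trans hab), max_eq_right h]
      rw [hza]
      exact mul_nonneg (sub_nonneg.2 hξ.1) (by nlinarith)
    · rcases le_total (√r) b with h' | h'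
      · have hzs : z = √r := by rw [hz, min_eq_left h', max_eq_left h]
        rw [hzs, hsq]; simp
      · have hzb : z = b := by rw [hz, min_eq_right h', max_eq_left hab]
        rw [hzb]
        exact mul_nonneg_of_nonpos_of_nonpos (sub_nonpos.2 hξ.2) (by nlinarith)
  have hid : ξ + r * (1 / ξ) - (z + r * (1 / z)) - (ξ - z) ^ 2 / ξ
      = (ξ - z) * (z ^ 2 - r) / (ξ * z) := by
    field_simp
    ring
  have := div_nonneg hvar (mul_pos hξ0 hz0).le
  linarith

theorem one_div_convex_comb_le {a b ε : ℝ} (ha : 0 < a) (hb : 0 < b) (h0 : 0 ≤ ε) (h1 : ε ≤ 1) :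
    1 / (a + ε * (b - a)) - 1 / a ≤ ε * (1 / b - 1 / a) := by
  have h := (convexOn_zpow (𝕜 := ℝ) (-1)).2 (mem_Ioi.2 ha) (mem_Ioi.2 hb) (sub_nonneg.2 h1) h0
    (by ring)
  simp only [smul_eq_mul, zpow_neg_one] at h
  rw [show (1 - ε) * a + ε * b = a + ε * (b - a) by ring] at h
  simp only [one_div]
  linarith

namespace APTModel

variable {N : ℕ} (P : APTModel N)

/-- The Hamiltonian `L + ∑ᵢ lᵢ Fᵢ` at the state `c`, the adjoint value `l` and the control value
`(ξ, η)`. -/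
def hamiltonian (c l ξ η : Fin N → ℝ) : ℝ := P.L c ξ η + ∑ i, l i * P.F c ξ η i

/-- The control value `ξ` of the optimality system. -/
def optX (c l : Fin N → ℝ) (i : Fin N) : ℝ := max (min (√(P.radicand c l i)) P.xhi) P.xlo

/-- The control value `η` of the optimality system, with the upper bound as the choice in the
undetermined case `l i * c i = 1`. -/
def optY (c l : Fin N → ℝ) (i : Fin N) : ℝ := if l i * c i < 1 then P.ylo else P.yhi

/-- The point at parameter `ε` on the segment from `u` to `v`. -/
def segPt (ε : ℝ) (u v : Fin N → ℝ) : Fin N → ℝ := fun i => u i + ε * (v i - u i)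

theorem radicand_nonneg {c l : Fin N → ℝ} (hc : ∀ i, c i ∈ Icc (0 : ℝ) 1) (hl : ∀ i, 0 ≤ l i)
    (i : Fin N) : 0 ≤ P.radicand c l i :=
  mul_nonneg (mul_nonneg (hl i) (P.pressure_nonneg (fun j => (hc j).1) i))
    (sub_nonneg.2 (hc i).2)

theorem hamiltonian_sub (c l ξ η ξ' η' : Fin N → ℝ) :
    P.hamiltonian c l ξ' η' - P.hamiltonian c l ξ η =
      ∑ i, ((ξ' i - ξ i + P.radicand c l i * (1 / ξ' i - 1 / ξ i))
        + (η' i - η i) * (1 - l i * c i)) := by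
  simp only [hamiltonian, L]
  rw [← Finset.sum_add_distrib, ← Finset.sum_add_distrib, ← Finset.sum_sub_distrib]
  refine Finset.sum_congr rfl fun i _ => ?_
  simp only [F, radicand]
  ring

variable {P}

theorem segPt_mem_Icc {ε a b : ℝ} {u v : Fin N → ℝ} {i : Fin N} (h0 : 0 ≤ ε) (h1 : ε ≤ 1)
    (hu : u i ∈ Icc a b) (hv : v i ∈ Icc a b) : segPt ε u v i ∈ Icc a b :=
  (convex_Icc a b).add_smul_sub_mem hu hv ⟨h0, h1⟩

theorem InBox.segPt {ε : ℝ} {ξ η ξ' η' : Fin N → ℝ} (h0 : 0 ≤ ε) (h1 : ε ≤ 1)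
    (hu : P.InBox ξ η) (hv : P.InBox ξ' η') :
    P.InBox (segPt ε ξ ξ') (segPt ε η η') :=
  ⟨fun i => segPt_mem_Icc h0 h1 (hu.1 i) (hv.1 i), fun i => segPt_mem_Icc h0 h1 (hu.2 i) (hv.2 i)⟩

theorem InBox.opt {ξ η : Fin N → ℝ} (hu : P.InBox ξ η) (c l : Fin N → ℝ) :
    P.InBox (P.optX c l) (P.optY c l) := by
  refine ⟨fun i => ⟨le_max_right _ _, max_le (min_le_right _ _) ((hu.1 i).1.trans (hu.1 i).2)⟩,
    fun i => ?_⟩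
  have := (hu.2 i).1.trans (hu.2 i).2
  unfold optY
  split_ifs
  · exact ⟨le_rfl, this⟩
  · exact ⟨this, le_rfl⟩

theorem InBox.optX_term_le {c l ξ η : Fin N → ℝ} (hu : P.InBox ξ η) {i : Fin N}
    (hr : 0 ≤ P.radicand c l i) :
    P.optX c l i - ξ i + P.radicand c l i * (1 / P.optX c l i - 1 / ξ i) ≤
      -((ξ i - P.optX c l i) ^ 2 / ξ i) := by
  have := sq_div_le_of_clamp_sqrt P.xlo_pos hr (hu.1 i)
  unfold optX
  linarith

theorem InBox.optY_term_nonpos {c l ξ η : Fin N → ℝ} (hu : P.InBox ξ η) (i : Fin N) :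
    (P.optY c l i - η i) * (1 - l i * c i) ≤ 0 := by
  unfold optY
  split_ifs with h
  · exact mul_nonpos_of_nonpos_of_nonneg (sub_nonpos.2 (hu.2 i).1) (by linarith)
  · exact mul_nonpos_of_nonneg_of_nonpos (sub_nonneg.2 (hu.2 i).2) (by linarith)

theorem InBox.hamiltonian_opt_le {c l ξ η : Fin N → ℝ} (hu : P.InBox ξ η)
    (hr : ∀ i, 0 ≤ P.radicand c l i) :
    P.hamiltonian c l (P.optX c l) (P.optY c l) ≤ P.hamiltonian c l ξ η := by
  rw [← sub_nonpos, hamiltonian_sub]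
  refine Finset.sum_nonpos fun i _ => add_nonpos ((hu.optX_term_le (hr i)).trans ?_)
    (hu.optY_term_nonpos i)
  have := hu.x_pos i
  rw [neg_nonpos]
  positivity

/-- The minimizer of the Hamiltonian over the control box is unique, except in the `η` components
on which it does not depend. -/
theorem InBox.eq_opt_of_hamiltonian_eq {c l ξ η : Fin N → ℝ} (hu : P.InBox ξ η)
    (hr : ∀ i, 0 ≤ P.radicand c l i)
    (h : P.hamiltonian c l (P.optX c l) (P.optY c l) - P.hamiltonian c l ξ η = 0) (i : Fin N) :
    ξ i = P.optX c l i ∧ (l i * c i < 1 → η i = P.ylo) ∧ (1 < l i * c i → η i = P.yhi) := by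
  have hsq : ∀ i, 0 ≤ (ξ i - P.optX c l i) ^ 2 / ξ i := fun i => by
    have := hu.x_pos i; positivity
  rw [hamiltonian_sub, Finset.sum_eq_zero_iff_of_nonpos fun i _ =>
    add_nonpos ((hu.optX_term_le (hr i)).trans (neg_nonpos.2 (hsq i))) (hu.optY_term_nonpos i)] at h
  have h1 := h i (Finset.mem_univ i)
  have h2 := hu.optX_term_le (hr i)
  have h3 := hu.optY_term_nonpos (c := c) (l := l) i
  have h4 := hsq i
  have h5 : (ξ i - P.optX c l i) ^ 2 / ξ i = 0 := by linarith
  have h6 : (P.optY c l i - η i) * (1 - l i * c i) = 0 := by linarith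
  refine ⟨?_, fun hlt => ?_, fun hlt => ?_⟩
  · rcases div_eq_zero_iff.1 h5 with h7 | h7
    · exact sub_eq_zero.1 (pow_eq_zero_iff two_ne_zero |>.1 h7)
    · exact absurd h7 (hu.x_pos i).ne'
  · rcases mul_eq_zero.1 h6 with h7 | h7
    · rw [optY, if_pos hlt] at h7; linarith
    · linarith
  · rcases mul_eq_zero.1 h6 with h7 | h7
    · rw [optY, if_neg hlt.not_gt] at h7; linarith
    · linarith

/-- The Hamiltonian is convex in the control when the radicands are nonnegative. -/
theorem InBox.hamiltonian_segPt_sub_le {ε : ℝ} {c l ξ η ξ' η' : Fin N → ℝ} (h0 : 0 ≤ ε)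
    (h1 : ε ≤ 1) (hu : P.InBox ξ η) (hv : P.InBox ξ' η') (hr : ∀ i, 0 ≤ P.radicand c l i) :
    P.hamiltonian c l (APTModel.segPt ε ξ ξ') (APTModel.segPt ε η η') - P.hamiltonian c l ξ η ≤
      ε * (P.hamiltonian c l ξ' η' - P.hamiltonian c l ξ η) := by
  rw [hamiltonian_sub, hamiltonian_sub, Finset.mul_sum]
  refine Finset.sum_le_sum fun i _ => ?_
  have h2 := mul_le_mul_of_nonneg_left
    (one_div_convex_comb_le (hu.x_pos i) (hv.x_pos i) h0 h1) (hr i)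
  simp only [APTModel.segPt]
  linarith

/-! ### The second order remainder -/

variable (P) in
/-- A bound for the rate of change of `1 / ξ` along a segment in the control box. -/
def invRate : ℝ := |P.xhi| / P.xlo ^ 2

theorem invRate_nonneg : 0 ≤ P.invRate := by unfold invRate; positivity

theorem InBox.abs_one_div_segPt_sub_le {ε : ℝ} {ξ η ξ' η' : Fin N → ℝ} (h0 : 0 ≤ ε) (h1 : ε ≤ 1)
    (hu : P.InBox ξ η) (hv : P.InBox ξ' η') (i : Fin N) :
    |1 / APTModel.segPt ε ξ ξ' i - 1 / ξ i| ≤ P.invRate * ε := by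
  have hw := hu.segPt h0 h1 hv
  have hlo := P.xlo_pos
  have hx := hu.x_pos i
  have hz := hw.x_pos i
  have hd : |ξ' i - ξ i| ≤ |P.xhi| := by
    have := le_abs_self P.xhi
    exact abs_le.2 ⟨by linarith [(hu.1 i).2, hv.x_pos i], by linarith [(hv.1 i).2]⟩
  have heq : 1 / APTModel.segPt ε ξ ξ' i - 1 / ξ i =
      -(ε * (ξ' i - ξ i)) / (APTModel.segPt ε ξ ξ' i * ξ i) := by
    rw [div_sub_div _ _ hz.ne' hx.ne']
    simp only [APTModel.segPt]
    ring
  rw [heq, abs_div, abs_neg, abs_mul, abs_of_nonneg h0, abs_of_pos (mul_pos hz hx), invRate,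
    div_mul_eq_mul_div, mul_comm |P.xhi|, sq]
  have := (hw.1 i).1
  have := (hu.1 i).1
  gcongr

theorem InBox.abs_segPt_sub_le {ε : ℝ} {ξ η ξ' η' : Fin N → ℝ} (h0 : 0 ≤ ε)
    (hu : P.InBox ξ η) (hv : P.InBox ξ' η') (i : Fin N) :
    |APTModel.segPt ε η η' i - η i| ≤ |P.yhi| * ε := by
  have h1 := hu.y_nonneg i
  have h2 := hv.y_nonneg i
  have h3 := hu.y_le i
  have h4 := hv.y_le i
  have : APTModel.segPt ε η η' i - η i = (η' i - η i) * ε := by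
    simp only [APTModel.segPt]; ring
  rw [this, abs_mul, abs_of_nonneg h0]
  exact mul_le_mul_of_nonneg_right (abs_le.2 ⟨by linarith, by linarith⟩) h0

theorem InBox.abs_F_segPt_sub_le {ε : ℝ} {c ξ η ξ' η' : Fin N → ℝ} (h0 : 0 ≤ ε) (h1 : ε ≤ 1)
    (hu : P.InBox ξ η) (hv : P.InBox ξ' η') (hc : ∀ i, c i ∈ Icc (0 : ℝ) 1) (i : Fin N) :
    |P.F c (APTModel.segPt ε ξ ξ') (APTModel.segPt ε η η') i - P.F c ξ η i| ≤
      (P.invRate * P.pressureBound 1 + |P.yhi|) * ε := by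
  have hca : ∀ j, |c j| ≤ 1 := fun j => abs_le.2 ⟨by linarith [(hc j).1], (hc j).2⟩
  have h2 : |1 - c i| ≤ 1 := abs_le.2 ⟨by linarith [(hc i).2], by linarith [(hc i).1]⟩
  have hx := hu.abs_one_div_segPt_sub_le h0 h1 hv i
  have hy := hu.abs_segPt_sub_le h0 hv i
  have hp := P.abs_pressure_le hca i
  have hR := P.invRate_nonneg
  calc _ = |(1 / APTModel.segPt ε ξ ξ' i - 1 / ξ i) * P.pressure c i * (1 - c i)
        - (APTModel.segPt ε η η' i - η i) * c i| := by
        unfold F; congr 1; ring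
    _ ≤ |1 / APTModel.segPt ε ξ ξ' i - 1 / ξ i| * |P.pressure c i| * |1 - c i|
        + |APTModel.segPt ε η η' i - η i| * |c i| := by
        refine (abs_sub _ _).trans ?_
        rw [abs_mul, abs_mul, abs_mul]
    _ ≤ P.invRate * ε * P.pressureBound 1 * 1 + |P.yhi| * ε * 1 := by
        have := P.pressureBound_nonneg zero_le_one
        gcongr
        exact hca i
    _ = _ := by ring

/-- Summation by parts over the edges of the network: the coupling term of the adjoint equation is
the transpose of that of the linearized state equation. -/
theorem sum_coupling_eq (c ξ l d : Fin N → ℝ) :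
    ∑ i, (P.β * ∑ j, P.A i j * (1 - c j) * l j / ξ j) * d i =
      ∑ i, l i * (1 / ξ i) * (1 - c i) * (P.β * ∑ j, P.A j i * d j) := by
  simp only [Finset.mul_sum, Finset.sum_mul]
  rw [Finset.sum_comm]
  refine Finset.sum_congr rfl fun i _ => Finset.sum_congr rfl fun j _ => ?_
  ring

/-- The integrand of the difference of the costs of two controls, after adding the derivative of
the pairing of the adjoint with the difference of the states: the first order terms in the state
cancel by the adjoint equation. -/
theorem costIncrement_eq (c c' ξ η ξ' η' l : Fin N → ℝ) :
    P.L c' ξ' η' - P.L c ξ η + ∑ i, (P.adjointRHS c ξ η l i * (c' i - c i)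
        + l i * (P.F c' ξ' η' i - P.F c ξ η i)) =
      P.hamiltonian c l ξ' η' - P.hamiltonian c l ξ η
      + ∑ i, l i * ((1 / ξ' i - 1 / ξ i) * ((P.β * ∑ j, P.A j i * (c' j - c j)) * (1 - c i)
          - P.pressure c i * (c' i - c i)) - (η' i - η i) * (c' i - c i)
          - 1 / ξ' i * (P.β * ∑ j, P.A j i * (c' j - c j)) * (c' i - c i)) := by
  have hcoup := sum_coupling_eq (P := P) c ξ l fun i => c' i - c i
  rw [← sub_eq_zero] at hcoup ⊢
  rw [← neg_eq_zero] at hcoup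
  rw [← hcoup]
  simp only [hamiltonian, L]
  simp only [← Finset.sum_add_distrib, ← Finset.sum_sub_distrib, ← Finset.sum_neg_distrib]
  refine Finset.sum_congr rfl fun i _ => ?_
  rw [← P.pressure_sub]
  simp only [F, adjointRHS]
  ring

variable (P) in
/-- The constant of the second order remainder, for adjoint values of size at most `B` and state
displacements of size at most `M * ε`. -/
def remainderConst (B M : ℝ) : ℝ :=
  N * (B * (P.invRate * (P.β * (N * M) + P.pressureBound 1 * M) + |P.yhi| * M
    + 1 / P.xlo * (P.β * (N * M)) * M))

theorem InBox.costIncrement_le {ε B M : ℝ} {c c' ξ η ξ' η' l : Fin N → ℝ} (h0 : 0 ≤ ε) (h1 : ε ≤ 1)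
    (hM : 0 ≤ M)
    (hu : P.InBox ξ η) (hv : P.InBox ξ' η') (hc : ∀ i, c i ∈ Icc (0 : ℝ) 1)
    (hl : ∀ i, 0 ≤ l i) (hlB : ∀ i, l i ≤ B) (hd : ∀ i, |c' i - c i| ≤ M * ε) :
    P.L c' (APTModel.segPt ε ξ ξ') (APTModel.segPt ε η η') - P.L c ξ η
      + ∑ i, (P.adjointRHS c ξ η l i * (c' i - c i)
        + l i * (P.F c' (APTModel.segPt ε ξ ξ') (APTModel.segPt ε η η') i - P.F c ξ η i)) ≤
      ε * (P.hamiltonian c l ξ' η' - P.hamiltonian c l ξ η) + P.remainderConst B M * ε ^ 2 := by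
  rw [costIncrement_eq]
  refine add_le_add (hu.hamiltonian_segPt_sub_le h0 h1 hv (P.radicand_nonneg hc hl)) ?_
  have hw := hu.segPt h0 h1 hv
  have hca : ∀ j, |c j| ≤ 1 := fun j => abs_le.2 ⟨by linarith [(hc j).1], (hc j).2⟩
  have hβ := P.β_pos
  have hlo := P.xlo_pos
  have hQ := P.pressureBound_nonneg zero_le_one
  have hR := P.invRate_nonneg
  refine (Finset.sum_le_sum (g := fun _ => B * (P.invRate * (P.β * (N * M) + P.pressureBound 1 * M)
    + |P.yhi| * M + 1 / P.xlo * (P.β * (N * M)) * M) * ε ^ 2) fun i _ => ?_).trans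
    (by simp [remainderConst]; apply le_of_eq; ring)
  have hx := hu.abs_one_div_segPt_sub_le h0 h1 hv i
  have hy := hu.abs_segPt_sub_le h0 hv i
  have hp := P.abs_pressure_le hca i
  have h2 : |1 - c i| ≤ 1 := abs_le.2 ⟨by linarith [(hc i).2], by linarith [(hc i).1]⟩
  have hxw := hw.one_div_le i
  have hxw0 := hw.one_div_nonneg i
  have hS : |P.β * ∑ j, P.A j i * (c' j - c j)| ≤ P.β * (N * (M * ε)) := by
    rw [abs_mul, abs_of_pos hβ]
    exact mul_le_mul_of_nonneg_left (P.abs_sum_A_mul_le hd i) hβ.le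
  have hdi := hd i
  have hB : 0 ≤ B := (hl i).trans (hlB i)
  set S := P.β * ∑ j, P.A j i * (c' j - c j)
  set e := APTModel.segPt ε ξ ξ' i
  set f := APTModel.segPt ε η η' i
  calc l i * ((1 / e - 1 / ξ i) * (S * (1 - c i) - P.pressure c i * (c' i - c i))
        - (f - η i) * (c' i - c i) - 1 / e * S * (c' i - c i))
      ≤ l i * (|1 / e - 1 / ξ i| * (|S| * |1 - c i| + |P.pressure c i| * |c' i - c i|)
        + |f - η i| * |c' i - c i| + 1 / e * |S| * |c' i - c i|) := by
        refine mul_le_mul_of_nonneg_left ((le_abs_self _).trans ?_) (hl i)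
        refine (abs_sub _ _).trans (add_le_add ((abs_sub _ _).trans (add_le_add ?_ ?_)) ?_)
        · rw [abs_mul]
          refine mul_le_mul_of_nonneg_left ((abs_sub _ _).trans ?_) (abs_nonneg _)
          rw [abs_mul S, abs_mul (P.pressure c i)]
        · rw [abs_mul]
        · rw [abs_mul, abs_mul, abs_of_nonneg hxw0]
    _ ≤ B * (P.invRate * ε * (P.β * (N * (M * ε)) * 1 + P.pressureBound 1 * (M * ε))
        + |P.yhi| * ε * (M * ε) + 1 / P.xlo * (P.β * (N * (M * ε))) * (M * ε)) := by
        gcongr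
        exact hlB i
    _ = _ := by ring

/-! ### Variation of the optimal control -/

instance : IsFiniteMeasure P.timeMeasure := by
  unfold timeMeasure; infer_instance

theorem Admissible.of_inBox {x y : ℝ → Fin N → ℝ}
    (hx : ∀ i, AEMeasurable (fun t => x t i) (volume.restrict (Icc 0 P.T)))
    (hy : ∀ i, AEMeasurable (fun t => y t i) (volume.restrict (Icc 0 P.T)))
    (h : ∀ᵐ t ∂volume.restrict (Icc 0 P.T), P.InBox (x t) (y t)) : P.Admissible x y where
  x_memLp i := by
    refine MemLp.of_bound (hx i).aestronglyMeasurable |P.xhi| ?_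
    filter_upwards [h] with t ht
    rw [Real.norm_of_nonneg (ht.x_pos i).le]
    exact (ht.1 i).2.trans (le_abs_self _)
  y_memLp i := by
    refine MemLp.of_bound (hy i).aestronglyMeasurable |P.yhi| ?_
    filter_upwards [h] with t ht
    rw [Real.norm_of_nonneg (ht.y_nonneg i)]
    exact ht.y_le i
  x_mem := by filter_upwards [h] with t ht using ht.1
  y_mem := by filter_upwards [h] with t ht using ht.2

theorem Admissible.integrableOn_x {x y : ℝ → Fin N → ℝ} (h : P.Admissible x y) (i : Fin N) :
    IntegrableOn (fun t => x t i) (Icc 0 P.T) :=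
  (h.x_memLp i).integrable (by norm_num)

theorem Admissible.integrableOn_y {x y : ℝ → Fin N → ℝ} (h : P.Admissible x y) (i : Fin N) :
    IntegrableOn (fun t => y t i) (Icc 0 P.T) :=
  (h.y_memLp i).integrable (by norm_num)

theorem Admissible.integrableOn_L {x y C : ℝ → Fin N → ℝ} (h : P.Admissible x y)
    (hC : ContinuousOn C (Icc 0 P.T)) :
    IntegrableOn (fun t => P.L (C t) (x t) (y t)) (Icc 0 P.T) := by
  unfold L
  refine integrable_finsetSum _ fun i _ => ?_
  have h1 : IntegrableOn (fun t => C t i) (Icc 0 P.T) :=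
    (continuousOn_pi.1 hC i).integrableOn_Icc
  exact ((h1.const_mul _).add (h.integrableOn_x i)).add (h.integrableOn_y i)

theorem Admissible.integrableOn_hamiltonian {x y C lam : ℝ → Fin N → ℝ} (h : P.Admissible x y)
    (hC : ContinuousOn C (Icc 0 P.T)) (hmem : ∀ t ∈ Icc 0 P.T, ∀ i, C t i ∈ Icc (0 : ℝ) 1)
    (hlam : ContinuousOn lam (Icc 0 P.T)) :
    IntegrableOn (fun t => P.hamiltonian (C t) (lam t) (x t) (y t)) (Icc 0 P.T) := by
  unfold hamiltonian
  refine (h.integrableOn_L hC).add (integrable_finsetSum _ fun i _ => ?_)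
  have hCm : ∀ i, AEMeasurable (fun t => C t i) (volume.restrict (Icc 0 P.T)) := fun i =>
    (continuousOn_pi.1 hC i).aemeasurable measurableSet_Icc
  have h1 : IntegrableOn (fun t => P.F (C t) (x t) (y t) i) (Icc 0 P.T) := by
    refine Integrable.of_bound (aemeasurable_F h.x_aemeasurable h.y_aemeasurable hCm
      i).aestronglyMeasurable (1 / P.xlo * P.pressureBound 1 + |P.yhi|) ?_
    filter_upwards [h.inBox, ae_restrict_mem (measurableSet_Icc (a := 0) (b := P.T))]
      with t hu ht using hu.abs_F_le (hmem t ht) i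
  exact h1.continuousOn_mul (continuousOn_pi.1 hlam i) isCompact_Icc

/-- Optimality of the control in integrated form: replacing its values by the pointwise minimizers
of the Hamiltonian does not decrease the integral of the Hamiltonian. The control is moved a small
step `ε` towards the minimizers; the gain is of first order in `ε`, and the change of the state
contributes at second order only. -/
theorem integral_hamiltonian_opt_sub_nonneg {x y C lam : ℝ → Fin N → ℝ}
    (hu : P.IsOptimalControl x y) (hC : P.IsState x y C) (hlamT : lam P.T = 0)
    (hac : ∀ i, AbsolutelyContinuousOnInterval (fun t => lam t i) 0 P.T)
    (hode : ∀ᵐ t ∂volume.restrict (Icc 0 P.T), ∀ i,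
      HasDerivAt (fun s => lam s i) (P.adjointRHS (C t) (x t) (y t) (lam t) i) t)
    (hpos : ∀ t ∈ Icc 0 P.T, ∀ i, 0 ≤ lam t i)
    {x' y' : ℝ → Fin N → ℝ} (h' : P.Admissible x' y') :
    0 ≤ ∫ t in (0 : ℝ)..P.T, (P.hamiltonian (C t) (lam t) (x' t) (y' t)
      - P.hamiltonian (C t) (lam t) (x t) (y t)) := by
  have hadm := hu.1
  have hT := P.T_pos
  have hCc := hC.continuousOn
  have hmem : ∀ t ∈ Icc 0 P.T, ∀ i, C t i ∈ Icc (0 : ℝ) 1 := fun t ht i => hC.mem_Icc hadm ht i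
  have hlamc : ContinuousOn lam (Icc 0 P.T) := continuousOn_pi.2 fun i => by
    have := (hac i).continuousOn
    rwa [uIcc_of_le hT.le] at this
  have hmemT := ae_restrict_mem (μ := volume) (measurableSet_Icc (a := 0) (b := P.T))
  obtain ⟨B, hB⟩ := isCompact_Icc.exists_bound_of_continuousOn hlamc
  set R := P.invRate * P.pressureBound 1 + |P.yhi| with hR
  have hR0 : 0 ≤ R := by
    have := P.pressureBound_nonneg zero_le_one
    have := P.invRate_nonneg
    positivity
  set M := 2 * P.T * Real.exp (2 * P.lipschitzConst 1 * P.T) * R with hM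
  have hM0 : 0 ≤ M := by positivity
  set g : ℝ → ℝ := fun t => P.hamiltonian (C t) (lam t) (x' t) (y' t)
      - P.hamiltonian (C t) (lam t) (x t) (y t) with hg
  have hgint : IntervalIntegrable g volume 0 P.T := by
    rw [intervalIntegrable_iff_integrableOn_Icc_of_le hT.le]
    exact (h'.integrableOn_hamiltonian hCc hmem hlamc).sub
      (hadm.integrableOn_hamiltonian hCc hmem hlamc)
  set K := P.remainderConst B M
  have key : ∀ ε, 0 ≤ ε → ε ≤ 1 → 0 ≤ ε * (∫ t in (0 : ℝ)..P.T, g t) + K * ε ^ 2 * P.T := by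
    intro ε h0 h1
    set xε : ℝ → Fin N → ℝ := fun t => segPt ε (x t) (x' t) with hxε
    set yε : ℝ → Fin N → ℝ := fun t => segPt ε (y t) (y' t) with hyε
    have hadmε : P.Admissible xε yε := by
      refine Admissible.of_inBox (fun i => ?_) (fun i => ?_) ?_
      · have := hadm.x_aemeasurable i
        have := h'.x_aemeasurable i
        simp only [hxε, segPt]
        fun_prop
      · have := hadm.y_aemeasurable i
        have := h'.y_aemeasurable i
        simp only [hyε, segPt]
        fun_prop
      · filter_upwards [hadm.inBox, h'.inBox] with t hu hv using hu.segPt h0 h1 hv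
    obtain ⟨Cε, hCε, hmemε⟩ := hadmε.exists_isState
    have hJ := hu.J_le hC hadmε hCε
    have hdist : ∀ t ∈ Icc 0 P.T, ∀ i, |Cε t i - C t i| ≤ M * ε := fun t ht i => by
      have hn := hC.norm_sub_le hCε hadmε (M := 1) (ε := R * ε) zero_le_one (by positivity)
        (fun t ht i => abs_le.2 ⟨by linarith [(hmem t ht i).1], (hmem t ht i).2⟩)
        (fun t ht i => abs_le.2 ⟨by linarith [(hmemε t ht i).1], (hmemε t ht i).2⟩)
        (by
          filter_upwards [hadm.inBox, h'.inBox, hmemT] with s hu hv hs i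
          exact hu.abs_F_segPt_sub_le h0 h1 hv (hmem s hs) i) ht
      rw [← mul_assoc, ← hM] at hn
      exact (norm_le_pi_norm (Cε t - C t) i).trans hn
    -- the pairing of the adjoint with the state displacement vanishes at both ends
    have hpair := (AbsolutelyContinuousOnInterval.sum Finset.univ
      (f := fun i t => lam t i * (Cε t i - C t i)) (a := 0) (b := P.T) fun i _ =>
        (hac i).fun_mul ((hCε.absCont i).fun_sub (hC.absCont i)))
    obtain ⟨hφint, hφ⟩ := hpair.integral_eq_sub_of_ae_hasDerivAt
      (f' := fun t => ∑ i, (P.adjointRHS (C t) (x t) (y t) (lam t) i * (Cε t i - C t i)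
        + lam t i * (P.F (Cε t) (xε t) (yε t) i - P.F (C t) (x t) (y t) i)))
      (by
        filter_upwards [hode, hC.ode, hCε.ode] with t h1 h2 h3
        exact HasDerivAt.fun_sum fun i _ => (h1 i).mul ((h3 i).sub (h2 i)))
      (left_mem_Icc.2 hT.le) (right_mem_Icc.2 hT.le)
    have hφ0 : ∑ i, lam P.T i * (Cε P.T i - C P.T i) - ∑ i, lam 0 i * (Cε 0 i - C 0 i) = 0 := by
      simp [hlamT, hC.init, hCε.init]
    rw [hφ0] at hφ
    have hL : IntervalIntegrable (fun t => P.L (C t) (x t) (y t)) volume 0 P.T := by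
      rw [intervalIntegrable_iff_integrableOn_Icc_of_le hT.le]
      exact hadm.integrableOn_L hCc
    have hLε : IntervalIntegrable (fun t => P.L (Cε t) (xε t) (yε t)) volume 0 P.T := by
      rw [intervalIntegrable_iff_integrableOn_Icc_of_le hT.le]
      exact hadmε.integrableOn_L hCε.continuousOn
    have hmono := intervalIntegral.integral_mono_ae_restrict hT.le ((hLε.sub hL).add hφint)
      ((hgint.const_mul ε).add (intervalIntegrable_const (c := K * ε ^ 2))) (by
        filter_upwards [hadm.inBox, h'.inBox, hmemT] with t hu hv ht
        exact hu.costIncrement_le h0 h1 hM0 hv (hmem t ht) (hpos t ht)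
          (fun i => (le_abs_self _).trans ((norm_le_pi_norm (lam t) i).trans (hB t ht)))
          (hdist t ht))
    rw [intervalIntegral.integral_add (hLε.sub hL) hφint, intervalIntegral.integral_sub hLε hL,
      intervalIntegral.integral_add (hgint.const_mul ε) intervalIntegrable_const, hφ,
      intervalIntegral.integral_const_mul, intervalIntegral.integral_const] at hmono
    simp only [J] at hJ
    rw [smul_eq_mul, sub_zero] at hmono
    linarith
  by_contra! hI
  set I := ∫ t in (0 : ℝ)..P.T, g t
  -- a step `ε` so short that the first order term dominates the remainder
  obtain ⟨ε, hε0, hε1, hε⟩ : ∃ ε > 0, ε ≤ 1 ∧ (|K| * P.T) * ε < -I := by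
    refine ⟨min 1 (-I / (|K| * P.T + 1)), lt_min one_pos (div_pos (by linarith) (by positivity)),
      min_le_left _ _, ?_⟩
    calc |K| * P.T * min 1 (-I / (|K| * P.T + 1)) ≤ |K| * P.T * (-I / (|K| * P.T + 1)) := by
          gcongr; exact min_le_right _ _
      _ = (-I) * (|K| * P.T / (|K| * P.T + 1)) := by ring
      _ < (-I) * 1 := by
          have : 0 < -I := by linarith
          gcongr
          rw [div_lt_one (by positivity)]
          linarith
      _ = -I := mul_one _
  have h1 := key ε hε0.le hε1
  have h2 : K * ε ^ 2 * P.T ≤ |K| * ε ^ 2 * P.T := by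
    gcongr; exact le_abs_self K
  nlinarith

end APTModel

/-- Every optimal control, with its state, satisfies the optimality system for some adjoint. -/
theorem theorem2 {N : ℕ} (P : APTModel N) (x y C : ℝ → Fin N → ℝ)
    (hu : P.IsOptimalControl x y) (hC : P.IsState x y C) :
    ∃ lam : ℝ → Fin N → ℝ, P.OptimalitySystem x y C lam := by
  have hadm := hu.1
  have hT := P.T_pos
  obtain ⟨lam, hlamT, hac, hode, hpos⟩ := APTModel.exists_adjoint hadm hC
  have hmem : ∀ t ∈ Icc 0 P.T, ∀ i, C t i ∈ Icc (0 : ℝ) 1 := fun t ht i => hC.mem_Icc hadm ht i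
  have hr : ∀ t ∈ Icc 0 P.T, ∀ i, 0 ≤ P.radicand (C t) (lam t) i := fun t ht i =>
    P.radicand_nonneg (hmem t ht) (hpos t ht) i
  have hCm : ∀ i, AEMeasurable (fun t => C t i) (volume.restrict (Icc 0 P.T)) := fun i =>
    (continuousOn_pi.1 hC.continuousOn i).aemeasurable measurableSet_Icc
  have hlamc : ContinuousOn lam (Icc 0 P.T) := continuousOn_pi.2 fun i => by
    have := (hac i).continuousOn
    rwa [uIcc_of_le hT.le] at this
  have hlm : ∀ i, AEMeasurable (fun t => lam t i) (volume.restrict (Icc 0 P.T)) := fun i =>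
    (continuousOn_pi.1 hlamc i).aemeasurable measurableSet_Icc
  have hopt : P.Admissible (fun t => P.optX (C t) (lam t)) fun t => P.optY (C t) (lam t) := by
    refine APTModel.Admissible.of_inBox (fun i => ?_) (fun i => ?_) ?_
    · have hp := APTModel.aemeasurable_pressure (P := P) hCm i
      have h1 : AEMeasurable (fun t => P.radicand (C t) (lam t) i)
          (volume.restrict (Icc 0 P.T)) := by
        unfold APTModel.radicand
        fun_prop
      exact (h1.sqrt.min aemeasurable_const).max aemeasurable_const
    · have h1 : Measurable fun z : ℝ => if z < 1 then P.ylo else P.yhi :=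
        Measurable.ite measurableSet_Iio measurable_const measurable_const
      exact h1.comp_aemeasurable ((hlm i).mul (hCm i))
    · filter_upwards [hadm.inBox] with t ht using ht.opt _ _
  have hint := APTModel.integral_hamiltonian_opt_sub_nonneg hu hC hlamT hac hode hpos hopt
  have hmemT := ae_restrict_mem (μ := volume) (measurableSet_Icc (a := 0) (b := P.T))
  have hgi : IntegrableOn (fun t => P.hamiltonian (C t) (lam t) (x t) (y t)
      - P.hamiltonian (C t) (lam t) (P.optX (C t) (lam t)) (P.optY (C t) (lam t)))
      (Icc 0 P.T) :=
    (hadm.integrableOn_hamiltonian hC.continuousOn hmem hlamc).sub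
      (hopt.integrableOn_hamiltonian hC.continuousOn hmem hlamc)
  have hnn : 0 ≤ᵐ[volume.restrict (Icc 0 P.T)] fun t => P.hamiltonian (C t) (lam t) (x t) (y t)
      - P.hamiltonian (C t) (lam t) (P.optX (C t) (lam t)) (P.optY (C t) (lam t)) := by
    filter_upwards [hadm.inBox, hmemT] with t hu ht
    exact sub_nonneg.2 (hu.hamiltonian_opt_le (hr t ht))
  have hzero : ∀ᵐ t ∂volume.restrict (Icc 0 P.T), P.hamiltonian (C t) (lam t) (x t) (y t)
      - P.hamiltonian (C t) (lam t) (P.optX (C t) (lam t)) (P.optY (C t) (lam t)) = 0 := by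
    refine (integral_eq_zero_iff_of_nonneg_ae hnn hgi).1 (le_antisymm ?_
      (integral_nonneg_of_ae hnn))
    rw [intervalIntegral.integral_of_le hT.le, ← integral_Icc_eq_integral_Ioc] at hint
    rw [← neg_nonneg, ← integral_neg]
    simpa only [neg_sub] using hint
  have hall : ∀ᵐ t ∂volume.restrict (Icc 0 P.T), ∀ i, x t i = P.optX (C t) (lam t) i ∧
      (lam t i * C t i < 1 → y t i = P.ylo) ∧ (1 < lam t i * C t i → y t i = P.yhi) := by
    filter_upwards [hadm.inBox, hmemT, hzero] with t hu ht h0 i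
    exact hu.eq_opt_of_hamiltonian_eq (hr t ht) (by linarith) i
  exact ⟨lam, {
    state := hC
    adjoint_absCont := hac
    adjoint_ode := hode
    transversality := hlamT
    radicand_nonneg := hr
    x_eq := by filter_upwards [hall] with t ht i using (ht i).1
    y_eq_lo := by filter_upwards [hall] with t ht i using (ht i).2.1
    y_eq_hi := by filter_upwards [hall] with t ht i using (ht i).2.2 }⟩

end
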